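/- **Notation.** Fix $\beta\ge 0$ and an integer $\rho\ge 1$. Let $\Gamma_0$ be a positively oriented circle of radius $r>0$ about $0$ and $L$ the upward vertical line $\mathrm{Re}\,\omega=s$ with $s>r$ (the statement holds for every such choice). For integers $\lambda,\kappa,u,v,n,n'$ and real $x,x',y$ let $$\mathcal K^\beta(\lambda,\kappa)=\oint_{\Gamma_0}\frac{d\zeta}{(2\pi i)^2}\int_L\frac{d\omega}{\omega-\zeta}\,\frac{e^{-2\zeta^2+4\beta\zeta}}{e^{-2\omega^2+4\beta\omega}}\,\frac{\zeta^\kappa}{\omega^{\lambda+1}},$$ $$\mathcal A^{\beta,y}_v(\kappa)=\oint_{\Gamma_0}\frac{d\zeta}{(2\pi i)^2}\int_L\frac{d\omega}{\zeta-\omega}\,\frac{e^{-\zeta^2-2y\zeta}}{e^{-2\omega^2+4\beta\omega}}\,\frac{\zeta^{-v}}{\omega^{\kappa+1}}+\int_L\frac{d\zeta}{2\pi i}\,\frac{e^{\zeta^2-2\zeta(y+2\beta)}}{\zeta^{v+\kappa+1}},$$ $$\mathcal B^{\beta,y}_u(\lambda)=\oint_{\Gamma_0}\frac{d\zeta}{(2\pi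 i)^2}\int_L\frac{d\omega}{\zeta-\omega}\,\frac{e^{-2\zeta^2+4\zeta\beta}}{e^{-\omega^2-2\omega y}}\,\frac{\zeta^{\lambda}}{\omega^{-u}}+\oint_{\Gamma_0}\frac{d\omega}{2\pi i}\,\frac{\omega^{u+\lambda}}{e^{\omega^2-2\omega(y+2\beta)}},$$ $$\mathbb K^{\rm minor}(n,x;n',x')=-\mathbf 1_{n>n'}2^{n-n'}\mathbf 1_{x\ge x'}\frac{(x-x')^{n-n'-1}}{(n-n'-1)!}+\frac{2}{(2\pi i)^2}\oint_{\Gamma_0}dz\int_L\frac{dw}{w-z}\,\frac{e^{-z^2+2zx}}{e^{-w^2+2wx'}}\,\frac{w^{n'}}{z^n}.$$ The edge-tacnode kernel is $$\mathbb K^{\rm TAC}_{\beta,\rho}(u_1,z_1;u_2,z_2)=\mathbb K^{\rm minor}(u_1,\beta-z_1;u_2,\beta-z_2)+2\sum_{\lambda\ge-\rho}\bigl((\mathbf 1-\mathcal K^\beta)^{-1}\mathcal A^{\beta,z_1-\beta}_{u_1}\bigr)(\lambda)\,\mathcal B^{\beta,z_2-\beta}_{u_2}(\lambda),$$ with the inverse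 taken in $\ell^2(\{-\rho,-\rho+1,\dots\})$. Let $$\Phi_n(\eta)=\frac{2^n}{\sqrt\pi\,n!}\int_0^\infty\xi^ne^{-(\xi-\eta)^2}d\xi\ (n\ge0),\qquad \Phi_n(\eta)=\frac{e^{-\eta^2}}{\sqrt\pi}\,\frac{H_{-n-1}(-\eta)}{2^{-n}}\ (n\le-1),$$ with $H_k(x)=(2x)^k+\cdots$ the Hermite polynomials, let $g(x)=e^{-x^2}/\sqrt\pi$, and, for $\delta\ge0$, $$D=\det(\mathbf 1-\mathcal K^\beta(\lambda,\kappa))_{-\rho\le\lambda,\kappa\le-1},\qquad c_{\rho,\delta}=D^{-1}\prod_{\ell=1}^{\delta-1}\frac{2^\ell}{\ell!}.$$ Let $\Delta_n(x)=\det(x_j^{k})_{0\le k\le n-1,\,1\le j\le n}$, and for $n\ge\rho$ let $\widetilde\Delta^{\beta\pm}_{n,\rho}(x)$ be the determinant with rows $1,x,\dots,x^{n-\rho-1},\Phi_{n-\rho}(\beta\pm x),\dots,\Phi_{n-1}(\beta\pm x)$ evaluated at $x=x_1,\dots,x_n$. The number of particles at level $u\in\mathbb Z$ of the edge-tacnode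 process is $\max(\rho-u,\rho)$ if $u\le\rho$, and $u$ if $u\ge\rho$. With $N$ this number, a law of the particles at level $u$ is a probability law of an ordered vector $z_1\le\dots\le z_N$ whose $m$-point correlation function is $\det(\mathbb K^{\rm TAC}_{\beta,\rho}(u,x_i;u,x_j))_{1\le i,j\le m}$ for every $m\ge0$. "The particles at level $u$ have density $p$" means that every such law is $p(z)\,dz$ on $\{z_1\le\dots\le z_N\}$. **Theorem 5.1.** The operator $\mathbf 1-\mathcal K^\beta$ is bijective on $\ell^2(\{-\rho,-\rho+1,\dots\})$, all sequences $\mathcal A^{\beta,y-\beta}_{u}$ lie in that space, and $D$ is real and positive. Moreover: 1. Let $u\le\rho$ be an integer and $N=\max(\rho-u,\rho)$. For all $z\in\mathbb R^N$, $$\det\bigl(\mathbb K^{\rm TAC}_{\beta,\rho}(u,z_i;u,z_j)\bigr)_{1\le i,j\le N}=(-1)^{\frac{\rho(\rho-1)}2+\rho\max(-u,0)}\,2^{\max(u,0)}\,c_{\rho,\max(-u,0)}\,\det M_1\,\det M_2,$$ where $M_1$ has the rows $y^0,\dots,y^{-u-1}$ (absent if $u\ge0$), $\Phi_{-u}(\beta-y),\dots,\Phi_{\rho-u-1}(\beta-y)$,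 and $M_2$ has the rows $y^0g(y+\beta),\dots,y^{\rho-u-1}g(y+\beta)$ (absent if $u=\rho$), $\Phi_0(\beta+y),\dots,\Phi_{u-1}(\beta+y)$ (absent if $u\le0$), both evaluated at $y=z_1,\dots,z_N$. The particles at level $u$ have this function of $z$ as their density. 2. (Outside the overlap.) Let $n\ge\rho$ and $\delta=n-\rho$. The particles $\mathbf x^{(n)}$ at level $n$ and $\mathbf y^{(n)}$ at level $\rho-n$ have, respectively, the densities $$c_{\rho,\delta}\,\widetilde\Delta^{\beta+}_{n,\rho}(x)\,\Delta_n(x)\prod_{i=1}^ng(x_i-\beta),\qquad(-1)^{\frac{\rho(\rho-1)}2+\rho\delta}\,c_{\rho,\delta}\,\Delta_n(y)\,\widetilde\Delta^{\beta-}_{n,\rho}(y)\prod_{i=1}^ng(y_i+\beta).$$ 3. (Inside the overlap.) Let $1\le\delta\le\rho-1$. The $\rho$ particles $(\mathbf y^{(\rho-\delta)},\mathbf x^{(\delta)})$ at level $\delta$ have the density $$(-1)^{\frac{\delta(\delta-1)}2+\delta(\rho-\delta)}\,c_{\rho,0}\,\det M_3\,\det M_4,$$ where $M_3$ has the rows $z^{\delta-1}g(\beta-z),\dots,g(\beta-z),\Phi_0(\beta-z),\dots,\Phi_{\rho-\delta-1}(\beta-z)$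 and $M_4$ has the rows $z^{\rho-\delta-1}g(z+\beta),\dots,g(z+\beta),\Phi_0(z+\beta),\dots,\Phi_{\delta-1}(z+\beta)$, both evaluated at $z=z_1,\dots,z_\rho$. In 2 and 3 the densities are also equal, at every real vector, to $\det(\mathbb K^{\rm TAC}_{\beta,\rho}(u,z_i;u,z_j))$ at the level $u$ in question. -/

import Mathlib

open MeasureTheory
open scoped ENNReal

noncomputable section

namespace Tacnode

/-! ### Contour integrals

`Γ₀` is the positively oriented circle of radius `r` about `0`, and `L` is the upward vertical line
`Re ω = s`; throughout `0 < r < s`, so that `L` lies to the right of `Γ₀`. -/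

/-- `(2πi)⁻¹ ∮_{Γ₀} f(ζ) dζ`. -/
def circleInt (r : ℝ) (f : ℂ → ℂ) : ℂ :=
  (2 * Real.pi * Complex.I)⁻¹ * ∮ z in C(0, r), f z

/-- `(2πi)⁻¹ ∫_L f(ω) dω`, along `ω = s + it`, `t` running upward through `ℝ`. -/
def lineInt (s : ℝ) (f : ℂ → ℂ) : ℂ :=
  (2 * Real.pi * Complex.I)⁻¹ * ∫ t : ℝ, f (s + t * Complex.I) * Complex.I

/-! ### The edge-tacnode kernel -/

/-- `ℍ^m(z) = 1_{z ≥ 0} z^{m-1}/(m-1)!`, used for `m ≥ 1`. -/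
def heavisidePow (m : ℕ) (z : ℝ) : ℝ :=
  if 0 ≤ z then z ^ (m - 1) / ((m - 1).factorial : ℝ) else 0

/-- The GUE-minor kernel `𝕂^minor(n, x; n', x')`, for `n, n' ∈ ℤ`. -/
def minorKernel (r s : ℝ) (n : ℤ) (x : ℝ) (n' : ℤ) (x' : ℝ) : ℂ :=
  -(if n' < n then ((2 ^ (n - n').toNat * heavisidePow (n - n').toNat (x - x') : ℝ) : ℂ) else 0)
  + 2 * circleInt r fun z => lineInt s fun w =>
      1 / (w - z) * (Complex.exp (-z ^ 2 + 2 * z * x) / Complex.exp (-w ^ 2 + 2 * w * x'))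
        * (w ^ n' / z ^ n)

/-- The kernel `𝒦^β(l, k)`, for `l, k ∈ ℤ`. -/
def kernelK (r s β : ℝ) (l k : ℤ) : ℂ :=
  circleInt r fun z => lineInt s fun w =>
    1 / (w - z) * (Complex.exp (-2 * z ^ 2 + 4 * β * z) / Complex.exp (-2 * w ^ 2 + 4 * β * w))
      * (z ^ k / w ^ (l + 1))

/-- The function `𝒜_v^{β,y}(k)`, for `v, k ∈ ℤ`. -/
def funA (r s β : ℝ) (v : ℤ) (y : ℝ) (k : ℤ) : ℂ :=
  (circleInt r fun z => lineInt s fun w =>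
    1 / (z - w) * (Complex.exp (-z ^ 2 - 2 * y * z) / Complex.exp (-2 * w ^ 2 + 4 * β * w))
      * (z ^ (-v) / w ^ (k + 1)))
  + lineInt s fun z => Complex.exp (z ^ 2 - 2 * z * (y + 2 * β)) / z ^ (v + k + 1)

/-- The function `ℬ_u^{β,y}(l)`, for `u, l ∈ ℤ`. -/
def funB (r s β : ℝ) (u : ℤ) (y : ℝ) (l : ℤ) : ℂ :=
  (circleInt r fun z => lineInt s fun w =>
    1 / (z - w) * (Complex.exp (-2 * z ^ 2 + 4 * z * β) / Complex.exp (-w ^ 2 - 2 * w * y))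
      * (z ^ l / w ^ (-u)))
  + circleInt r fun w => w ^ (u + l) / Complex.exp (w ^ 2 - 2 * w * (y + 2 * β))

/-- A sequence on `{-ρ, -ρ+1, …}` is written `i ↦ a (i - ρ)`, `i ∈ ℕ`.  This says that the sequence
`g` is in `ℓ²(-ρ, …, ∞)` and satisfies `(1 - 𝒦^β) g = a` there. -/
def IsResolventSolution (r s β : ℝ) (ρ : ℕ) (a g : ℕ → ℂ) : Prop :=
  (Summable fun i => ‖g i‖ ^ 2) ∧
  ∀ i : ℕ, HasSum (fun j : ℕ => kernelK r s β ((i : ℤ) - ρ) ((j : ℤ) - ρ) * g j) (g i - a i)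

open Classical in
/-- `(1 - 𝒦^β)⁻¹ a` in `ℓ²(-ρ, …, ∞)`. -/
def resolventApply (r s β : ℝ) (ρ : ℕ) (a : ℕ → ℂ) : ℕ → ℂ :=
  if h : ∃ g, IsResolventSolution r s β ρ a g then h.choose else 0

/-- The edge-tacnode kernel `𝕂^TAC_{β,ρ}(u₁, z₁; u₂, z₂)`. -/
def tacnodeKernel (r s β : ℝ) (ρ : ℕ) (u₁ : ℤ) (z₁ : ℝ) (u₂ : ℤ) (z₂ : ℝ) : ℂ :=
  minorKernel r s u₁ (β - z₁) u₂ (β - z₂)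
  + 2 * ∑' i : ℕ, resolventApply r s β ρ (fun j => funA r s β u₁ (z₁ - β) ((j : ℤ) - ρ)) i
      * funB r s β u₂ (z₂ - β) ((i : ℤ) - ρ)

/-- `det (𝕂^TAC(u, z_i; u, z_j))_{i,j}`. -/
def tacnodeDet (r s β : ℝ) (ρ : ℕ) (u : ℤ) {m : ℕ} (z : Fin m → ℝ) : ℂ :=
  Matrix.det (Matrix.of fun i j : Fin m => tacnodeKernel r s β ρ u (z i) u (z j))

/-! ### The one-level law -/

/-- `P` is the law, on ordered `N`-tuples `z₁ ≤ … ≤ z_N`, of the particles at level `u` of a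
determinantal process with the edge-tacnode kernel (only the marginal at that level matters): the `m`-point correlation function of `z₁, …, z_N` is
`det (𝕂^TAC(u, x_i; u, x_j))_{1 ≤ i,j ≤ m}`, for every `m`.  The sum runs over all `m`-tuples of
distinct particles. -/
structure IsTacnodeLevelLaw (r s β : ℝ) (ρ : ℕ) (u : ℤ) (N : ℕ)
    (P : Measure (Fin N → ℝ)) : Prop where
  isProbabilityMeasure : IsProbabilityMeasure P
  ordered : ∀ᵐ z ∂P, Monotone z
  nonneg : ∀ m : ℕ, ∀ᵐ x : Fin m → ℝ, ∃ t : ℝ, 0 ≤ t ∧ tacnodeDet r s β ρ u x = (t : ℂ)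
  correlation : ∀ (m : ℕ) (f : (Fin m → ℝ) → ℝ≥0∞), Measurable f →
    ∫⁻ z, ∑ e : Fin m ↪ Fin N, f (z ∘ e) ∂P
      = ∫⁻ x : Fin m → ℝ, f x * ENNReal.ofReal (tacnodeDet r s β ρ u x).re

/-- The ordered vector of the `N` particles at level `u` has density `p`:
`ℙ^TAC(z^{(u)} ∈ dz) = p(z) dz` on `{z₁ ≤ … ≤ z_N}`. -/
def HasLevelDensity (r s β : ℝ) (ρ : ℕ) (u : ℤ) (N : ℕ) (p : (Fin N → ℝ) → ℝ) : Prop :=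
  ∀ P : Measure (Fin N → ℝ), IsTacnodeLevelLaw r s β ρ u N P →
    P = ((volume : Measure (Fin N → ℝ)).restrict {z | Monotone z}).withDensity
      fun z => ENNReal.ofReal (p z)

/-! ### The functions in the densities -/

/-- The standard (physicists') Hermite polynomial `H_n(x) = (2x)^n + …`. -/
def hermiteH (n : ℕ) (x : ℝ) : ℝ :=
  Real.sqrt 2 ^ n * Polynomial.aeval (Real.sqrt 2 * x) (Polynomial.hermite n)

/-- `Φ_n(η)` for `n ∈ ℤ`: a Gaussian moment on the half-line if `n ≥ 0`, and a Hermite polynomial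
times a Gaussian if `n ≤ -1` (`Int.negSucc m` is `-(m+1)`). -/
def Phi : ℤ → ℝ → ℝ
  | Int.ofNat n, η =>
      2 ^ n / (Real.sqrt Real.pi * n.factorial)
        * ∫ ξ in Set.Ioi (0 : ℝ), ξ ^ n * Real.exp (-(ξ - η) ^ 2)
  | Int.negSucc m, η =>
      Real.exp (-η ^ 2) / Real.sqrt Real.pi * (hermiteH m (-η) / 2 ^ (m + 1))

/-- `e^{-x²}/√π`. -/
def gauss (x : ℝ) : ℝ := Real.exp (-x ^ 2) / Real.sqrt Real.pi

/-- `det (1 - 𝒦^β)_{[-1,-ρ]}`. -/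
def fredholmDet (r s β : ℝ) (ρ : ℕ) : ℂ :=
  Matrix.det ((1 : Matrix (Fin ρ) (Fin ρ) ℂ) -
    Matrix.of fun i j : Fin ρ => kernelK r s β (-1 - ((i : ℕ) : ℤ)) (-1 - ((j : ℕ) : ℤ)))

/-- `c_{ρ,δ} = ∏_{l=1}^{δ-1} (2^l / l!) · (det (1 - 𝒦^β)_{[-1,-ρ]})⁻¹`. -/
def constC (r s β : ℝ) (ρ δ : ℕ) : ℝ :=
  (∏ l ∈ Finset.Ico 1 δ, (2 : ℝ) ^ l / (l.factorial : ℝ)) * (fredholmDet r s β ρ).re⁻¹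

/-- The determinant with the rows `y^0, …, y^{-u-1}` (only if `u ≤ -1`) followed by
`Φ_{-u}(β-y), …, Φ_{ρ-u-1}(β-y)`, at `y = z₁, …, z_N`, where `N = max(ρ-u, ρ)`. -/
def firstDet (β : ℝ) (u : ℤ) {N : ℕ} (z : Fin N → ℝ) : ℝ :=
  Matrix.det (Matrix.of fun k j : Fin N =>
    if ((k : ℕ) : ℤ) < -u then z j ^ (k : ℕ) else Phi (((k : ℕ) : ℤ) - max u 0) (β - z j))

/-- The determinant with the rows `y^0 e^{-(y+β)²}/√π, …, y^{ρ-u-1} e^{-(y+β)²}/√π`, followed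
(only if `u ≥ 1`) by `Φ_0(β+y), …, Φ_{u-1}(β+y)`, at `y = z₁, …, z_N`, where
`N = max(ρ-u, ρ)`. -/
def secondDet (β : ℝ) (ρ : ℕ) (u : ℤ) {N : ℕ} (z : Fin N → ℝ) : ℝ :=
  Matrix.det (Matrix.of fun k j : Fin N =>
    if ((k : ℕ) : ℤ) < ρ - u then z j ^ (k : ℕ) * gauss (z j + β)
    else Phi (((k : ℕ) : ℤ) - (ρ - u)) (β + z j))

/-- The Vandermonde determinant `Δ_n(x)`, with rows `1, x, …, x^{n-1}`. -/
def vander {n : ℕ} (x : Fin n → ℝ) : ℝ :=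
  Matrix.det (Matrix.of fun k j : Fin n => x j ^ (k : ℕ))

/-- The extended Vandermonde determinant with rows `1, x, …, x^{n-ρ-1}`,
`Φ_{n-ρ}(β + σx), …, Φ_{n-1}(β + σx)`; here `σ = 1` for `Δ̃^{β+}` and `σ = -1` for `Δ̃^{β-}`. -/
def vanderExt (β σ : ℝ) (ρ : ℕ) {n : ℕ} (x : Fin n → ℝ) : ℝ :=
  Matrix.det (Matrix.of fun k j : Fin n =>
    if (k : ℕ) + ρ < n then x j ^ (k : ℕ) else Phi ((k : ℕ) : ℤ) (β + σ * x j))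

/-- The determinant with rows `z^{d-1} e^{-(z+b)²}/√π, …, e^{-(z+b)²}/√π`,
`Φ_0(b'), …, Φ_{ρ-d-1}(b')`, where `b' = σ(z + b)`. -/
def overlapDet (b σ : ℝ) (d : ℕ) {ρ : ℕ} (z : Fin ρ → ℝ) : ℝ :=
  Matrix.det (Matrix.of fun k j : Fin ρ =>
    if (k : ℕ) < d then z j ^ (d - 1 - (k : ℕ)) * gauss (z j + b)
    else Phi (((k : ℕ) : ℤ) - d) (σ * (z j + b)))

/-- The product formula for the density at a level `u ≤ ρ`, with its constant. -/
def levelProduct (r s β : ℝ) (ρ : ℕ) (u : ℤ) {N : ℕ} (z : Fin N → ℝ) : ℝ :=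
  (-1) ^ (ρ * (ρ - 1) / 2 + ρ * (-u).toNat) * 2 ^ u.toNat * constC r s β ρ (-u).toNat
    * firstDet β u z * secondDet β ρ u z

/-- The density of `x^{(n)}` outside the overlap, `n ≥ ρ`. -/
def densityX (r s β : ℝ) (ρ : ℕ) {n : ℕ} (x : Fin n → ℝ) : ℝ :=
  constC r s β ρ (n - ρ) * vanderExt β 1 ρ x * vander x * ∏ i, gauss (x i - β)

/-- The density of `y^{(n)}` outside the overlap, `n ≥ ρ`. -/
def densityY (r s β : ℝ) (ρ : ℕ) {n : ℕ} (y : Fin n → ℝ) : ℝ :=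
  (-1) ^ (ρ * (ρ - 1) / 2 + ρ * (n - ρ)) * constC r s β ρ (n - ρ)
    * vander y * vanderExt β (-1) ρ y * ∏ i, gauss (y i + β)

/-- The density of `(y^{(ρ-d)}, x^{(d)})` inside the overlap, `1 ≤ d ≤ ρ - 1`. -/
def densityOverlap (r s β : ℝ) {ρ : ℕ} (d : ℕ) (z : Fin ρ → ℝ) : ℝ :=
  (-1) ^ (d * (d - 1) / 2 + d * (ρ - d)) * constC r s β ρ 0
    * overlapDet (-β) (-1) d z * overlapDet β 1 (ρ - d) z

end Tacnode

end

noncomputable section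

namespace Tacnode

/-! ### Circle moments of quadratic exponentials -/

/-! At one level the kernel has rank at most the number `N` of particles, so its `N`-point
determinant is a product of two `N × N` determinants; the rest is row reduction of the two factors.

Finite rank: in each double contour integral `1/(w - z)` is expanded in powers of `z/w`, and terms
holomorphic in the disc integrate to zero. Every kernel becomes a finite sum of circle moments times
line moments of `exp (a w² + c w)` (`circleInt_lineInt_eq_sum`). In particular `𝒦(l, k) = 0` for `k
≥ 0`, so inverting `1 - 𝒦` is a `ρ × ρ` problem (`existsUnique_isResolventSolution`). Circle moments
are Taylor coefficients, hence convolve (`circMom_add`). This writes the minor kernel as `-2 ∑ cMom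
· ℬ` and `𝒜` as a line moment minus `𝒦 cMom`. The full kernel is therefore `2 ∑ G ℬ` with `G = (1 -
𝒦)⁻¹ 𝒜 - cMom`, where `(1 - 𝒦) G` is explicit and `ℬ` is a unipotent Toeplitz matrix applied to
explicit rows. `tacnodeDet_eq_mul_det` collects this.

A line moment minus the circle moment is a line moment on the other side of the origin
(`lineMom_sub_lineMom_neg`), and for `a = 1` line moments are values of `Phi` (`lineMom_one`). So
each explicit row is `± Phi`, or up to sign a circle moment, which is a polynomial in the position;
`Phi` of negative index is a polynomial times a Gaussian. `det_poly_rows` replaces polynomials by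
monomials, and the leading coefficients and row reversals give the constants and signs.

Positivity of `D`: up to cancelling signs and a unipotent factor, `1 - 𝒦` is a matrix of line
moments, equal to a positive diagonal matrix times the positive definite moment matrix of a Gaussian
on the half-line times a triangular matrix with positive diagonal (`det_realMom_pos`).

Finally, for exactly `N` particles the `N`-point correlation function determines the ordered law
(`hasLevelDensity_of_tacnodeDet_eq`). -/

lemma circleInt_eq_zero_of_differentiable {r : ℝ} (hr : 0 < r) {f : ℂ → ℂ}
    (hf : ∀ z ∈ Metric.closedBall (0 : ℂ) r, DifferentiableAt ℂ f z) : circleInt r f = 0 := by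
  unfold circleInt
  rw [Complex.circleIntegral_eq_zero_of_differentiable_on_off_countable hr.le Set.countable_empty
    (fun z hz => (hf z hz).continuousAt.continuousWithinAt)
    (fun z hz => hf z (Metric.ball_subset_closedBall hz.1)), mul_zero]

lemma circleInt_congr {r : ℝ} (hr : 0 < r) {f g : ℂ → ℂ}
    (h : ∀ z ∈ Metric.sphere (0 : ℂ) r, f z = g z) : circleInt r f = circleInt r g := by
  unfold circleInt
  rw [circleIntegral.integral_congr hr.le h]

lemma circleInt_const_mul (r : ℝ) (a : ℂ) (f : ℂ → ℂ) :
    circleInt r (fun z => a * f z) = a * circleInt r f := by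
  unfold circleInt
  rw [circleIntegral.integral_const_mul]
  ring

lemma circleInt_add {r : ℝ} (hr : 0 < r) {f g : ℂ → ℂ}
    (hf : ContinuousOn f (Metric.sphere (0 : ℂ) r)) (hg : ContinuousOn g (Metric.sphere (0 : ℂ) r)) :
    circleInt r (fun z => f z + g z) = circleInt r f + circleInt r g := by
  unfold circleInt
  rw [circleIntegral.integral_add (hf.circleIntegrable hr.le) (hg.circleIntegrable hr.le), mul_add]

lemma circleInt_sum {r : ℝ} (hr : 0 < r) {ι : Type*} (S : Finset ι) {f : ι → ℂ → ℂ}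
    (hf : ∀ i ∈ S, ContinuousOn (f i) (Metric.sphere (0 : ℂ) r)) :
    circleInt r (fun z => ∑ i ∈ S, f i z) = ∑ i ∈ S, circleInt r (f i) := by
  unfold circleInt
  rw [circleIntegral.integral_fun_sum (fun i hi => (hf i hi).circleIntegrable hr.le),
    Finset.mul_sum]

lemma ne_zero_of_mem_sphere {r : ℝ} (hr : 0 < r) {z : ℂ} (hz : z ∈ Metric.sphere (0 : ℂ) r) :
    z ≠ 0 := by
  rintro rfl
  simp at hz
  exact hr.ne hz

lemma continuousOn_zpow_mul {r : ℝ} (hr : 0 < r) (m : ℤ) {e : ℂ → ℂ} (he : Continuous e) :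
    ContinuousOn (fun z => z ^ m * e z) (Metric.sphere (0 : ℂ) r) :=
  (continuousOn_id.zpow₀ m fun _ hz => Or.inl (ne_zero_of_mem_sphere hr hz)).mul he.continuousOn

lemma circleInt_zpow_mul_eq_zero {r : ℝ} (hr : 0 < r) {m : ℤ} (hm : 0 ≤ m) {e : ℂ → ℂ}
    (he : Differentiable ℂ e) : circleInt r (fun z => z ^ m * e z) = 0 := by
  obtain ⟨n, rfl⟩ := Int.eq_ofNat_of_zero_le hm
  refine circleInt_eq_zero_of_differentiable hr fun z _ => ?_
  simp only [zpow_natCast]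
  exact (differentiableAt_id.pow n).mul (he z)

/-- The quadratic exponential `exp (a w² + c w)`. -/
def qexp (a c w : ℂ) : ℂ := Complex.exp (a * w ^ 2 + c * w)

lemma differentiable_qexp (a c : ℂ) : Differentiable ℂ (qexp a c) := by
  unfold qexp; fun_prop

lemma continuous_qexp (a c : ℂ) : Continuous (qexp a c) := (differentiable_qexp a c).continuous

lemma hasDerivAt_qexp (a c w : ℂ) : HasDerivAt (qexp a c) ((2 * a * w + c) * qexp a c w) w := by
  unfold qexp
  have h : HasDerivAt (fun w : ℂ => a * w ^ 2 + c * w) (2 * a * w + c) w := by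
    refine (((hasDerivAt_pow 2 w).const_mul a).add ((hasDerivAt_id w).const_mul c)).congr_deriv ?_
    push_cast; ring
  exact h.cexp.congr_deriv (by ring)

lemma qexp_mul (a a' c c' w : ℂ) : qexp a c w * qexp a' c' w = qexp (a + a') (c + c') w := by
  unfold qexp
  rw [← Complex.exp_add]
  ring_nf

/-- The moment `(2πi)⁻¹ ∮ w^m exp (a w² + c w) dw`. -/
def circMom (r : ℝ) (a c : ℂ) (m : ℤ) : ℂ := circleInt r fun w => w ^ m * qexp a c w

lemma circMom_of_nonneg {r : ℝ} (hr : 0 < r) (a c : ℂ) {m : ℤ} (hm : 0 ≤ m) :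
    circMom r a c m = 0 :=
  circleInt_zpow_mul_eq_zero hr hm (differentiable_qexp a c)

lemma circMom_neg_one {r : ℝ} (hr : 0 < r) (a c : ℂ) : circMom r a c (-1) = 1 := by
  have h := DiffContOnCl.circleIntegral_sub_inv_smul
    ((differentiable_qexp a c).diffContOnCl (s := Metric.ball 0 r)) (Metric.mem_ball_self hr)
  unfold circMom circleInt
  simp only [sub_zero, smul_eq_mul] at h
  simp only [zpow_neg_one, h]
  have : qexp a c 0 = 1 := by simp [qexp]
  rw [this, mul_one, inv_mul_cancel₀]
  simp [Real.pi_ne_zero]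

lemma hasDerivAt_zpow_mul_qexp (a c : ℂ) (m : ℤ) {w : ℂ} (hw : w ≠ 0) :
    HasDerivAt (fun w => w ^ m * qexp a c w)
      (m * (w ^ (m - 1) * qexp a c w) + 2 * a * (w ^ (m + 1) * qexp a c w)
        + c * (w ^ m * qexp a c w)) w := by
  refine ((hasDerivAt_zpow m w (Or.inl hw)).mul (hasDerivAt_qexp a c w)).congr_deriv ?_
  rw [zpow_add_one₀ hw]
  ring

/-- An exact derivative integrates to zero around the circle. Line moments obey the same recurrence,
which is how the two are compared later. -/
lemma circMom_rec {r : ℝ} (hr : 0 < r) (a c : ℂ) (m : ℤ) :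
    m * circMom r a c (m - 1) + 2 * a * circMom r a c (m + 1) + c * circMom r a c m = 0 := by
  have h := circleIntegral.integral_eq_zero_of_hasDerivWithinAt hr.le fun z hz =>
    (hasDerivAt_zpow_mul_qexp a c m (ne_zero_of_mem_sphere hr hz)).hasDerivWithinAt
  have h2 : circleInt r (fun w => m * (w ^ (m - 1) * qexp a c w)
      + 2 * a * (w ^ (m + 1) * qexp a c w) + c * (w ^ m * qexp a c w)) = 0 := by
    unfold circleInt; rw [h, mul_zero]
  have hc := fun n : ℤ => continuousOn_zpow_mul hr n (continuous_qexp a c)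
  have hm := fun (b : ℂ) (n : ℤ) => (hc n).const_mul b
  rw [circleInt_add hr ((hm m (m - 1)).fun_add (hm (2 * a) (m + 1))) (hm c m),
    circleInt_add hr (hm m (m - 1)) (hm (2 * a) (m + 1)), circleInt_const_mul,
    circleInt_const_mul, circleInt_const_mul] at h2
  exact h2

/-- The remainder has to be entire, not merely small, so that the circle integral annihilates it
once the power of `z` in front is nonnegative. -/
lemma exists_taylor_remainder {e : ℂ → ℂ} (he : Differentiable ℂ e) (n : ℕ) :
    ∃ (a : ℕ → ℂ) (q : ℂ → ℂ), Differentiable ℂ q ∧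
      ∀ z, e z = ∑ k ∈ Finset.range n, a k * z ^ k + z ^ n * q z := by
  induction n with
  | zero => exact ⟨0, e, he, fun z => by simp⟩
  | succ n ih =>
    obtain ⟨a, q, hq, h⟩ := ih
    refine ⟨Function.update a n (q 0), dslope q 0, ?_, fun z => ?_⟩
    · rw [← differentiableOn_univ] at hq ⊢
      exact (Complex.differentiableOn_dslope Filter.univ_mem).2 hq
    · rw [Finset.sum_range_succ, Function.update_self, h z]
      have h1 : q z = q 0 + z * dslope q 0 z := by
        have := sub_smul_dslope q 0 z
        simp only [sub_zero, smul_eq_mul] at this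
        rw [this]; ring
      rw [Finset.sum_congr rfl fun k hk => (by
        rw [Function.update_of_ne (Finset.mem_range.1 hk).ne] :
        Function.update a n (q 0) k * z ^ k = a k * z ^ k)]
      rw [h1, pow_succ]
      ring

/-- Cauchy product of Taylor series, read off as residues; `N + n ≥ 0` makes the contribution of the
remainder holomorphic. -/
lemma circleInt_zpow_mul_mul {r : ℝ} (hr : 0 < r) {e₁ e₂ : ℂ → ℂ} (h₁ : Differentiable ℂ e₁)
    (h₂ : Differentiable ℂ e₂) {N : ℤ} {n : ℕ} (hn : 0 ≤ N + n) :
    circleInt r (fun z => z ^ N * (e₁ z * e₂ z)) = ∑ k ∈ Finset.range n,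
      circleInt r (fun z => z ^ (-(k : ℤ) - 1) * e₁ z) * circleInt r (fun z => z ^ (N + k) * e₂ z) := by
  obtain ⟨a, q, hq, h⟩ := exists_taylor_remainder h₁ n
  -- Used twice: with `e₂` it expands the product, and with the constant `1` it identifies the
  -- coefficient `a k` as a circle integral.
  have key : ∀ {e : ℂ → ℂ} (he : Differentiable ℂ e) (L : ℤ), 0 ≤ L + n →
      circleInt r (fun z => z ^ L * (e₁ z * e z))
        = ∑ k ∈ Finset.range n, a k * circleInt r (fun z => z ^ (L + k) * e z) := by
    intro e he L hL
    have hc := fun m : ℤ => continuousOn_zpow_mul hr m he.continuous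
    rw [circleInt_congr hr (g := fun z => (∑ k ∈ Finset.range n, a k * (z ^ (L + k) * e z))
      + z ^ (L + n) * (q z * e z)) fun z hz => ?_]
    · rw [circleInt_add hr (continuousOn_finsetSum _ fun k _ => (hc _).const_mul _)
        (continuousOn_zpow_mul hr _ (hq.fun_mul he).continuous),
        circleInt_zpow_mul_eq_zero hr hL (hq.fun_mul he), add_zero,
        circleInt_sum hr _ fun k _ => (hc _).const_mul _]
      simp only [circleInt_const_mul]
    · have hz0 := ne_zero_of_mem_sphere hr hz
      simp only [h z, zpow_add₀ hz0, zpow_natCast, add_mul, Finset.sum_mul, mul_add, Finset.mul_sum]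
      congr 1
      · exact Finset.sum_congr rfl fun k _ => by ring
      · ring
  rw [key h₂ N hn]
  refine Finset.sum_congr rfl fun k hk => ?_
  congr 1
  have hk' := Finset.mem_range.1 hk
  have h3 := key (differentiable_const (1 : ℂ)) (-(k : ℤ) - 1) (by omega)
  simp only [mul_one] at h3
  rw [h3, Finset.sum_eq_single k]
  · have := circMom_neg_one hr 0 0
    simp only [circMom, qexp, zero_mul, add_zero, Complex.exp_zero, mul_one] at this
    rw [show -(k : ℤ) - 1 + k = -1 by ring, this, mul_one]
  · intro j _ hj
    unfold circleInt
    have := circleIntegral.integral_sub_zpow_of_ne (n := -(k : ℤ) - 1 + j) (by omega) 0 0 r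
    simp only [sub_zero] at this
    rw [this, mul_zero, mul_zero]
  · intro h; exact absurd hk h

lemma circMom_add {r : ℝ} (hr : 0 < r) (a₁ c₁ a₂ c₂ : ℂ) {N : ℤ} {n : ℕ} (hn : 0 ≤ N + n) :
    circMom r (a₁ + a₂) (c₁ + c₂) N
      = ∑ k ∈ Finset.range n, circMom r a₁ c₁ (-(k : ℤ) - 1) * circMom r a₂ c₂ (N + k) := by
  have := circleInt_zpow_mul_mul hr (differentiable_qexp a₁ c₁) (differentiable_qexp a₂ c₂) hn
  simp only [qexp_mul] at this
  exact this

/-! ### Iterated circle and line integrals -/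

lemma lineInt_const_mul (s : ℝ) (a : ℂ) (f : ℂ → ℂ) :
    lineInt s (fun z => a * f z) = a * lineInt s f := by
  unfold lineInt
  simp only [mul_assoc, integral_const_mul]
  ring

lemma lineInt_congr {s : ℝ} {f g : ℂ → ℂ} (h : ∀ t : ℝ, f (s + t * Complex.I) = g (s + t * Complex.I)) :
    lineInt s f = lineInt s g := by
  unfold lineInt
  simp only [h]

lemma lineInt_sum {s : ℝ} {ι : Type*} (S : Finset ι) {f : ι → ℂ → ℂ}
    (hf : ∀ i ∈ S, Integrable fun t : ℝ => f i (s + t * Complex.I)) :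
    lineInt s (fun z => ∑ i ∈ S, f i z) = ∑ i ∈ S, lineInt s (f i) := by
  unfold lineInt
  simp only [Finset.sum_mul]
  rw [integral_finsetSum _ fun i hi => (hf i hi).mul_const _, Finset.mul_sum]

lemma line_ne_zero {s : ℝ} (hs : 0 < s) (t : ℝ) : (s + t * Complex.I : ℂ) ≠ 0 := by
  intro h
  have := congrArg Complex.re h
  simp at this
  exact hs.ne' this

lemma le_norm_line (s t : ℝ) : s ≤ ‖(s + t * Complex.I : ℂ)‖ := by
  have := Complex.abs_re_le_norm (s + t * Complex.I : ℂ)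
  simp at this
  exact (le_abs_self s).trans this

lemma sub_le_norm_line_sub_circle {r s : ℝ} (hr : 0 < r) (t θ : ℝ) :
    s - r ≤ ‖(s + t * Complex.I - circleMap 0 r θ : ℂ)‖ := by
  have := Complex.re_le_norm (s + t * Complex.I - circleMap 0 r θ : ℂ)
  have h2 := Complex.re_le_norm (circleMap 0 r θ)
  rw [norm_circleMap_zero, abs_of_pos hr] at h2
  simp at this
  linarith

/-- Fubini: on the two contours `|w - z| ≥ s - r > 0`, so the integrand is dominated by a product of
integrable functions. -/
lemma circleInt_lineInt_swap {r s : ℝ} (hr : 0 < r) (hrs : r < s) {f h : ℂ → ℂ}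
    (hf : ContinuousOn f (Metric.sphere (0 : ℂ) r))
    (hc : Continuous fun t : ℝ => h (s + t * Complex.I))
    (hi : Integrable fun t : ℝ => h (s + t * Complex.I)) :
    circleInt r (fun z => lineInt s fun w => 1 / (w - z) * (f z * h w))
      = lineInt s fun w => circleInt r fun z => 1 / (w - z) * (f z * h w) := by
  unfold circleInt lineInt circleIntegral
  simp only [smul_eq_mul, ← integral_const_mul, ← intervalIntegral.integral_const_mul,
    ← intervalIntegral.integral_mul_const]
  simp only [intervalIntegral.integral_of_le Real.two_pi_pos.le]
  have hne : ∀ t θ : ℝ, (s + t * Complex.I - circleMap 0 r θ : ℂ) ≠ 0 := fun t θ h => by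
    have := sub_le_norm_line_sub_circle (s := s) hr t θ
    rw [h, norm_zero] at this
    linarith
  rw [integral_integral_swap]
  · refine integral_congr_ae (Filter.Eventually.of_forall fun t => ?_)
    refine integral_congr_ae (Filter.Eventually.of_forall fun θ => ?_)
    simp only
    ring
  · have hfc : Continuous fun θ => f (circleMap 0 r θ) :=
      hf.comp_continuous (continuous_circleMap 0 r) fun θ => by simp [abs_of_pos hr]
    have hg : Integrable (fun θ => f (circleMap 0 r θ)) (volume.restrict (Set.Ioc 0 (2 * Real.pi))) :=
      (hfc.integrableOn_Icc).mono_set Set.Ioc_subset_Icc_self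
    have hprod := hg.mul_prod hi
    refine Integrable.mono' (hprod.norm.const_mul
      (r / (s - r) * ‖(2 * Real.pi * Complex.I : ℂ)⁻¹‖ ^ 2)) ?_ (Filter.Eventually.of_forall ?_)
    · refine Continuous.aestronglyMeasurable ?_
      have h1 : Continuous fun p : ℝ × ℝ => (s + p.2 * Complex.I - circleMap 0 r p.1 : ℂ)⁻¹ := by
        refine Continuous.inv₀ ?_ fun p => hne _ _
        have := continuous_circleMap 0 r
        fun_prop
      have h2 := (continuous_circleMap 0 r).comp (continuous_fst (X := ℝ) (Y := ℝ))
      have h3 := hfc.comp (continuous_fst (X := ℝ) (Y := ℝ))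
      have h4 := hc.comp (continuous_snd (X := ℝ) (Y := ℝ))
      simp only [Function.uncurry_def, deriv_circleMap, one_div]
      simp only [Function.comp_def] at h2 h3 h4
      refine continuous_const.mul ((h2.mul continuous_const).mul (continuous_const.mul
        ((h1.mul (h3.mul h4)).mul continuous_const)))
    · rintro ⟨θ, t⟩
      have h1 := sub_le_norm_line_sub_circle (s := s) hr t θ
      have h2 : ‖(s + t * Complex.I - circleMap 0 r θ : ℂ)‖⁻¹ ≤ (s - r)⁻¹ :=
        inv_anti₀ (by linarith) h1
      simp only [Function.uncurry_apply_pair, deriv_circleMap, one_div, norm_mul, norm_inv,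
        Complex.norm_I, norm_circleMap_zero, abs_of_pos hr, mul_one]
      calc _ = ‖(s + t * Complex.I - circleMap 0 r θ : ℂ)‖⁻¹ * (r *
            (‖(2 : ℂ)‖ * ‖(Real.pi : ℂ)‖)⁻¹ ^ 2
            * (‖f (circleMap 0 r θ)‖ * ‖h (s + t * Complex.I)‖)) := by ring
        _ ≤ (s - r)⁻¹ * (r * (‖(2 : ℂ)‖ * ‖(Real.pi : ℂ)‖)⁻¹ ^ 2
            * (‖f (circleMap 0 r θ)‖ * ‖h (s + t * Complex.I)‖)) := by
          gcongr
        _ = _ := by ring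

/-- Since `|z| = r < |w|`, the geometric expansion of `1/(w - z)` can be stopped after `m` terms:
the remainder is holomorphic in the closed disc, so the finite sum is exact. -/
lemma circleInt_div_sub {r : ℝ} (hr : 0 < r) {w : ℂ} (hw : r < ‖w‖) {e : ℂ → ℂ}
    (he : Differentiable ℂ e) {ν : ℤ} {m : ℕ} (hm : 0 ≤ ν + m) :
    circleInt r (fun z => 1 / (w - z) * (z ^ ν * e z))
      = ∑ k ∈ Finset.range m, circleInt r (fun z => z ^ (ν + k) * e z) * w ^ (-(k : ℤ) - 1) := by
  have hw0 : w ≠ 0 := norm_pos_iff.1 (hr.trans hw)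
  have hne : ∀ z ∈ Metric.closedBall (0 : ℂ) r, w - z ≠ 0 := fun z hz h => by
    rw [sub_eq_zero.1 h] at hw
    simp at hz
    linarith
  rw [circleInt_congr hr (g := fun z => (∑ k ∈ Finset.range m,
    w ^ (-(k : ℤ) - 1) * (z ^ (ν + k) * e z)) + w ^ (-(m : ℤ)) * (z ^ (ν + m) * e z * (w - z)⁻¹))
    fun z hz => ?_]
  · have hq : ∀ z ∈ Metric.closedBall (0 : ℂ) r,
        DifferentiableAt ℂ (fun z => w ^ (-(m : ℤ)) * (z ^ (ν + m) * e z * (w - z)⁻¹)) z := by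
      intro z hz
      obtain ⟨n, hn⟩ := Int.eq_ofNat_of_zero_le hm
      simp only [hn, zpow_natCast]
      exact (((differentiableAt_id.pow n).mul (he z)).mul
        ((differentiableAt_id.const_sub w).inv (hne z hz))).const_mul _
    rw [circleInt_add hr (continuousOn_finsetSum _ fun k _ =>
      (continuousOn_zpow_mul hr _ he.continuous).const_mul _)
      (fun z hz => (hq z (Metric.sphere_subset_closedBall hz)).continuousAt.continuousWithinAt),
      circleInt_eq_zero_of_differentiable hr hq, add_zero,
      circleInt_sum hr _ fun k _ => (continuousOn_zpow_mul hr _ he.continuous).const_mul _]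
    simp only [circleInt_const_mul]
    exact Finset.sum_congr rfl fun k _ => mul_comm _ _
  · have hz0 := ne_zero_of_mem_sphere hr hz
    have hwz := hne z (Metric.sphere_subset_closedBall hz)
    have geom : 1 / (w - z) = ∑ k ∈ Finset.range m, w ^ (-(k : ℤ) - 1) * z ^ k
        + w ^ (-(m : ℤ)) * z ^ m * (w - z)⁻¹ := by
      clear hm
      induction m with
      | zero => simp
      | succ m ih =>
        rw [Finset.sum_range_succ, ih, add_assoc]
        congr 1
        push_cast
        rw [neg_add, ← sub_eq_add_neg, zpow_sub₀ hw0, zpow_one, pow_succ]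
        field_simp
        ring
    simp only [geom, add_mul, Finset.sum_mul, zpow_add₀ hz0, zpow_natCast]
    congr 1
    · exact Finset.sum_congr rfl fun k _ => by ring
    · ring

/-- The double contour integrals of the kernel reduce to finite sums of products of single ones. -/
lemma circleInt_lineInt_eq_sum {r s : ℝ} (hr : 0 < r) (hrs : r < s) {e h : ℂ → ℂ}
    (he : Differentiable ℂ e) {ν : ℤ} {m : ℕ} (hm : 0 ≤ ν + m)
    (hc : Continuous fun t : ℝ => h (s + t * Complex.I))
    (hi : ∀ k : ℕ, Integrable fun t : ℝ =>
      (s + t * Complex.I : ℂ) ^ (-(k : ℤ)) * h (s + t * Complex.I)) :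
    circleInt r (fun z => lineInt s fun w => 1 / (w - z) * (z ^ ν * e z * h w))
      = ∑ k ∈ Finset.range m, circleInt r (fun z => z ^ (ν + k) * e z)
        * lineInt s fun w => w ^ (-(k : ℤ) - 1) * h w := by
  rw [circleInt_lineInt_swap hr hrs (continuousOn_zpow_mul hr ν he.continuous) hc
    (by simpa using hi 0)]
  rw [lineInt_congr (g := fun w => ∑ k ∈ Finset.range m, circleInt r (fun z => z ^ (ν + k) * e z)
    * (w ^ (-(k : ℤ) - 1) * h w)) fun t => ?_]
  · rw [lineInt_sum _ fun k _ => ?_]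
    · simp only [lineInt_const_mul]
    · have := hi (k + 1)
      refine Integrable.const_mul ?_ _
      convert this using 4
      push_cast; ring
  · have := circleInt_div_sub hr (hrs.trans_le (le_norm_line s t)) he hm
    rw [circleInt_congr hr (g := fun z => h (s + t * Complex.I) *
      (1 / (s + t * Complex.I - z) * (z ^ ν * e z))) fun z _ => by ring, circleInt_const_mul, this,
      Finset.mul_sum]
    exact Finset.sum_congr rfl fun k _ => by ring

/-! ### Line moments of quadratic exponentials -/

/-- The moment `(2πi)⁻¹ ∫_L w^m exp (a w² + c w) dw`. -/
def lineMom (s : ℝ) (a c : ℝ) (m : ℤ) : ℂ := lineInt s fun w => w ^ m * qexp a c w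

lemma norm_qexp_line (s a c t : ℝ) :
    ‖qexp a c (s + t * Complex.I)‖ = Real.exp (a * (s ^ 2 - t ^ 2) + c * s) := by
  unfold qexp
  rw [Complex.norm_exp]
  congr 1
  simp [pow_two]

/-- The bound `e^t + e^{-t}` dominates `e^{|t|}` and, multiplied by a Gaussian, remains a sum of two
explicit Gaussians. -/
lemma exists_norm_zpow_line_le {s : ℝ} (hs : 0 < s) (m : ℤ) :
    ∃ C : ℝ, ∀ t : ℝ, ‖(s + t * Complex.I : ℂ) ^ m‖ ≤ C * (Real.exp t + Real.exp (-t)) := by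
  have h1 : ∀ t : ℝ, Real.exp |t| ≤ Real.exp t + Real.exp (-t) := fun t => by
    rcases abs_cases t with ⟨h, -⟩ | ⟨h, -⟩ <;> rw [h] <;> linarith [Real.exp_pos t, Real.exp_pos (-t)]
  obtain ⟨n, rfl | rfl⟩ := m.eq_nat_or_neg
  · refine ⟨n.factorial * Real.exp s, fun t => ?_⟩
    have h2 : ‖(s + t * Complex.I : ℂ)‖ ≤ s + |t| := by
      refine (norm_add_le _ _).trans ?_
      simp [abs_of_pos hs]
    rw [zpow_natCast, norm_pow]
    calc _ ≤ (s + |t|) ^ n := by gcongr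
      _ ≤ n.factorial * Real.exp (s + |t|) := by
        have := Real.pow_div_factorial_le_exp (s + |t|) (by positivity) n
        rwa [div_le_iff₀ (by positivity), mul_comm] at this
      _ = n.factorial * Real.exp s * Real.exp |t| := by rw [Real.exp_add]; ring
      _ ≤ _ := by gcongr; exact h1 t
  · refine ⟨(s ^ n)⁻¹, fun t => ?_⟩
    have h2 : 1 ≤ Real.exp t + Real.exp (-t) := (Real.one_le_exp (abs_nonneg t)).trans (h1 t)
    rw [zpow_neg, zpow_natCast, norm_inv, norm_pow]
    calc _ ≤ (s ^ n)⁻¹ * 1 := by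
          rw [mul_one]
          exact inv_anti₀ (by positivity) (by gcongr; exact le_norm_line s t)
      _ ≤ _ := by gcongr

lemma continuous_line_zpow_mul {s : ℝ} (hs : 0 < s) (m : ℤ) {e : ℂ → ℂ} (he : Continuous e) :
    Continuous fun t : ℝ => (s + t * Complex.I : ℂ) ^ m * e (s + t * Complex.I) := by
  have h : Continuous fun t : ℝ => (s + t * Complex.I : ℂ) := by fun_prop
  exact (h.zpow₀ m fun t => Or.inl (line_ne_zero hs t)).mul (he.comp h)

lemma integrable_line {s a : ℝ} (hs : 0 < s) (ha : 0 < a) (c : ℝ) (m : ℤ) :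
    Integrable fun t : ℝ => (s + t * Complex.I : ℂ) ^ m * qexp a c (s + t * Complex.I) := by
  obtain ⟨C, hC⟩ := exists_norm_zpow_line_le hs m
  have hg : ∀ σ : ℝ, Integrable fun t : ℝ =>
      Real.exp (σ * t) * Real.exp (a * (s ^ 2 - t ^ 2) + c * s) := fun σ => by
    have := (integrable_cexp_quadratic (b := a) (by simpa using ha) σ (a * s ^ 2 + c * s)).norm
    refine this.congr (Filter.Eventually.of_forall fun t => ?_)
    simp only [Complex.norm_exp]
    rw [← Real.exp_add]
    congr 1
    simp [pow_two]
    ring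
  refine Integrable.mono' (((hg 1).add (hg (-1))).const_mul C)
    (continuous_line_zpow_mul hs m (continuous_qexp _ _)).aestronglyMeasurable
    (Filter.Eventually.of_forall fun t => ?_)
  rw [norm_mul, norm_qexp_line]
  calc _ ≤ C * (Real.exp t + Real.exp (-t)) * Real.exp (a * (s ^ 2 - t ^ 2) + c * s) := by
        gcongr; exact hC t
    _ = _ := by simp only [Pi.add_apply, one_mul, neg_one_mul]; ring

lemma lineMom_rec {s a : ℝ} (hs : 0 < s) (ha : 0 < a) (c : ℝ) (m : ℤ) :
    m * lineMom s a c (m - 1) + 2 * a * lineMom s a c (m + 1) + c * lineMom s a c m = 0 := by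
  have hi := fun n => integrable_line hs ha c n
  have hm := fun (b : ℂ) (n : ℤ) => (hi n).const_mul b
  have hd : ∀ t : ℝ, HasDerivAt
      (fun t : ℝ => (s + t * Complex.I : ℂ) ^ m * qexp a c (s + t * Complex.I))
      ((m * ((s + t * Complex.I : ℂ) ^ (m - 1) * qexp a c (s + t * Complex.I))
        + 2 * a * ((s + t * Complex.I : ℂ) ^ (m + 1) * qexp a c (s + t * Complex.I))
        + c * ((s + t * Complex.I : ℂ) ^ m * qexp a c (s + t * Complex.I))) * Complex.I) t := by
    intro t
    have h1 : HasDerivAt (fun t : ℝ => (s + t * Complex.I : ℂ)) Complex.I t := by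
      have := ((hasDerivAt_id t).ofReal_comp.mul_const Complex.I).const_add (s : ℂ)
      simpa using this
    exact (hasDerivAt_zpow_mul_qexp a c m (line_ne_zero hs t)).comp t h1
  have h := integral_eq_zero_of_hasDerivAt_of_integrable hd
    (((((hm m (m - 1)).add (hm (2 * a) (m + 1))).add (hm c m))).mul_const _) (hi m)
  have h2 : lineInt s (fun w => m * (w ^ (m - 1) * qexp a c w)
      + 2 * a * (w ^ (m + 1) * qexp a c w) + c * (w ^ m * qexp a c w)) = 0 := by
    unfold lineInt
    rw [h, mul_zero]
  unfold lineInt at h2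
  simp only [add_mul] at h2
  have hM := fun (b : ℂ) (n : ℤ) => (hm b n).mul_const Complex.I
  rw [integral_add ((hM m (m - 1)).fun_add (hM (2 * a) (m + 1))) (hM c m),
    integral_add (hM m (m - 1)) (hM (2 * a) (m + 1))] at h2
  simp only [mul_assoc, integral_const_mul] at h2
  unfold lineMom lineInt
  simp only [mul_assoc]
  linear_combination h2

/-- `(2πi)⁻¹ ∫_L exp (a w² + c w) dw`. -/
def gaussMom (a c : ℝ) : ℝ := Real.exp (-c ^ 2 / (4 * a)) / (2 * Real.sqrt (Real.pi * a))

lemma lineMom_zero {s a : ℝ} (ha : 0 < a) (c : ℝ) : lineMom s a c 0 = gaussMom a c := by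
  have h := integral_cexp_quadratic (b := -(a : ℂ)) (by simpa using ha)
    ((2 * a * s + c) * Complex.I) (a * s ^ 2 + c * s)
  unfold lineMom lineInt qexp
  simp only [zpow_zero, one_mul, integral_mul_const]
  have h1 : (fun t : ℝ => Complex.exp (a * (s + t * Complex.I) ^ 2 + c * (s + t * Complex.I)))
      = fun t : ℝ => Complex.exp (-a * t ^ 2 + (2 * a * s + c) * Complex.I * t
        + (a * s ^ 2 + c * s)) := by
    funext t
    congr 1
    linear_combination (a : ℂ) * t ^ 2 * Complex.I_sq
  rw [h1, h]
  have h2 : (Real.pi / - -(a : ℂ)) ^ (1 / 2 : ℂ) = (Real.sqrt (Real.pi / a) : ℂ) := by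
    rw [Real.sqrt_eq_rpow, Complex.ofReal_cpow (by positivity)]
    push_cast
    rw [neg_neg]
  have h3 : (a * s ^ 2 + c * s - ((2 * a * s + c) * Complex.I) ^ 2 / (4 * -(a : ℂ)) : ℂ)
      = ((-c ^ 2 / (4 * a) : ℝ) : ℂ) := by
    have : (a : ℂ) ≠ 0 := by exact_mod_cast ha.ne'
    push_cast
    rw [mul_pow, Complex.I_sq]
    field_simp
    ring
  rw [h2, h3, ← Complex.ofReal_exp]
  unfold gaussMom
  have h4 : Real.sqrt (Real.pi / a) = Real.pi / Real.sqrt (Real.pi * a) := by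
    rw [Real.sqrt_div Real.pi_pos.le, Real.sqrt_mul Real.pi_pos.le]
    have := Real.mul_self_sqrt Real.pi_pos.le
    have : Real.sqrt Real.pi ≠ 0 := by positivity
    have : Real.sqrt a ≠ 0 := by positivity
    field_simp
    nlinarith
  rw [h4]
  have h5 : (Real.pi : ℂ) ≠ 0 := by exact_mod_cast Real.pi_ne_zero
  have h6 : (Real.sqrt (Real.pi * a) : ℂ) ≠ 0 := by
    exact_mod_cast (Real.sqrt_pos.2 (by positivity)).ne'
  push_cast
  field_simp

lemma integrableOn_pow_mul_exp_neg {x : ℝ} (hx : 0 < x) (n : ℕ) :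
    IntegrableOn (fun ξ : ℝ => ξ ^ n * Real.exp (-x * ξ)) (Set.Ioi 0) := by
  have := integrableOn_rpow_mul_exp_neg_mul_rpow (p := 1) (s := n) (b := x)
    (by have : (0 : ℝ) ≤ n := by positivity
        linarith) one_pos hx
  simpa using this

lemma integrableOn_pow_mul_cexp_neg {w : ℂ} (hw : 0 < w.re) (n : ℕ) :
    IntegrableOn (fun ξ : ℝ => (ξ : ℂ) ^ n * Complex.exp (-w * ξ)) (Set.Ioi 0) := by
  refine Integrable.mono' (integrableOn_pow_mul_exp_neg hw n)
    (Continuous.aestronglyMeasurable (by fun_prop)) ?_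
  refine (ae_restrict_iff' measurableSet_Ioi).2 (Filter.Eventually.of_forall fun ξ hξ => ?_)
  have hξ' : (0 : ℝ) < ξ := hξ
  simp [Complex.norm_exp, abs_of_pos hξ']

lemma integral_pow_mul_cexp_neg {w : ℂ} (hw : 0 < w.re) (n : ℕ) :
    ∫ ξ in Set.Ioi (0 : ℝ), (ξ : ℂ) ^ n * Complex.exp (-w * ξ) = n.factorial / w ^ (n + 1) := by
  have hw0 : w ≠ 0 := fun h => by simp [h] at hw
  have hexp : ∀ ξ : ℝ, HasDerivAt (fun ξ : ℝ => Complex.exp (-w * ξ))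
      (-w * Complex.exp (-w * ξ)) ξ := fun ξ => by
    have h1 : HasDerivAt (fun ξ : ℝ => -w * (ξ : ℂ)) (-w) ξ := by
      simpa using (hasDerivAt_id ξ).ofReal_comp.const_mul (-w)
    exact h1.cexp.congr_deriv (mul_comm _ _)
  have htend : ∀ n : ℕ, Filter.Tendsto (fun ξ : ℝ => (ξ : ℂ) ^ n * Complex.exp (-w * ξ))
      Filter.atTop (nhds 0) := fun n => by
    rw [tendsto_zero_iff_norm_tendsto_zero]
    refine (tendsto_rpow_mul_exp_neg_mul_atTop_nhds_zero n w.re hw).congr' ?_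
    filter_upwards [Filter.eventually_gt_atTop 0] with ξ hξ
    simp [Complex.norm_exp, abs_of_pos hξ]
  induction n with
  | zero =>
    have h := integral_Ioi_of_hasDerivAt_of_tendsto' (fun ξ _ => hexp ξ)
      (IntegrableOn.congr_fun ((integrableOn_pow_mul_cexp_neg hw 0).const_mul (-w))
        (fun ξ _ => by simp) measurableSet_Ioi) (a := 0)
      (by simpa using htend 0)
    rw [integral_const_mul] at h
    simp only [pow_zero, one_mul, Nat.factorial_zero, Nat.cast_one, zero_add, pow_one]
    rw [eq_div_iff hw0]
    simp at h ⊢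
    linear_combination h
  | succ n ih =>
    have hd : ∀ ξ : ℝ, HasDerivAt (fun ξ : ℝ => (ξ : ℂ) ^ (n + 1) * Complex.exp (-w * ξ))
        ((n + 1) * ((ξ : ℂ) ^ n * Complex.exp (-w * ξ))
          + -w * ((ξ : ℂ) ^ (n + 1) * Complex.exp (-w * ξ))) ξ := fun ξ => by
      refine (((hasDerivAt_id ξ).ofReal_comp.pow (n + 1)).mul (hexp ξ)).congr_deriv ?_
      simp
      ring
    have hi := fun (b : ℂ) (k : ℕ) => (integrableOn_pow_mul_cexp_neg hw k).const_mul b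
    have h := integral_Ioi_of_hasDerivAt_of_tendsto' (fun ξ _ => hd ξ)
      ((hi (n + 1) n).add (hi (-w) (n + 1))) (a := 0) (htend (n + 1))
    rw [integral_add (hi (n + 1) n) (hi (-w) (n + 1)), integral_const_mul, integral_const_mul,
      ih] at h
    rw [Nat.factorial_succ, pow_succ w (n + 1)]
    simp at h
    push_cast
    field_simp at h ⊢
    linear_combination -h

lemma qexp_sub (a c ξ : ℝ) (w : ℂ) :
    qexp a ((c - ξ : ℝ) : ℂ) w = Complex.exp (-w * ξ) * qexp a c w := by
  unfold qexp
  rw [← Complex.exp_add]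
  congr 1
  push_cast
  ring

/-- Dividing by a power of `w` amounts to a Laplace transform in the linear parameter. -/
lemma lineMom_laplace {s a : ℝ} (hs : 0 < s) (ha : 0 < a) (c : ℝ) (p : ℤ) (n : ℕ) :
    lineMom s a c (p - (n + 1)) = (n.factorial : ℂ)⁻¹ *
      ∫ ξ in Set.Ioi (0 : ℝ), (ξ : ℂ) ^ n * lineMom s a (c - ξ) p := by
  have hn : (n.factorial : ℂ) ≠ 0 := by exact_mod_cast n.factorial_ne_zero
  rw [eq_inv_mul_iff_mul_eq₀ hn]
  unfold lineMom lineInt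
  simp only [← integral_const_mul]
  rw [integral_integral_swap]
  · refine integral_congr_ae (Filter.Eventually.of_forall fun t => ?_)
    have hw := line_ne_zero hs t
    have hre : 0 < (s + t * Complex.I : ℂ).re := by simpa using hs
    have h1 := integral_pow_mul_cexp_neg hre n
    simp only
    calc _ = (2 * Real.pi * Complex.I)⁻¹ * ((s + t * Complex.I) ^ p * qexp a c (s + t * Complex.I)
          * Complex.I) * (n.factorial / (s + t * Complex.I) ^ (n + 1)) := by
          rw [zpow_sub₀ hw]
          norm_cast
          ring
      _ = ∫ ξ in Set.Ioi (0 : ℝ), (2 * Real.pi * Complex.I)⁻¹ * ((s + t * Complex.I) ^ p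
          * qexp a c (s + t * Complex.I) * Complex.I)
          * (ξ ^ n * Complex.exp (-(s + t * Complex.I) * ξ)) := by
          rw [integral_const_mul, h1]
      _ = _ := by
        refine integral_congr_ae (Filter.Eventually.of_forall fun ξ => ?_)
        simp only [qexp_sub]
        ring
  · have hprod := (integrableOn_pow_mul_exp_neg hs n).mul_prod (integrable_line hs ha c p).norm
    refine Integrable.mono' (hprod.const_mul ‖(2 * Real.pi * Complex.I : ℂ)⁻¹‖) ?_ ?_
    · refine Continuous.aestronglyMeasurable ?_
      simp only [Function.uncurry_def, qexp_sub]
      have h1 := (continuous_line_zpow_mul hs p (continuous_qexp a c)).comp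
        (continuous_snd (X := ℝ) (Y := ℝ))
      simp only [Function.comp_def] at h1
      have h2 : Continuous fun x : ℝ × ℝ => (x.1 : ℂ) ^ n *
          Complex.exp (-(s + x.2 * Complex.I) * x.1) := by fun_prop
      have h3 := (h2.mul h1).const_mul ((2 * Real.pi * Complex.I : ℂ)⁻¹ * Complex.I)
      refine h3.congr fun x => ?_
      simp only [Pi.mul_apply]
      ring
    · rw [← Measure.restrict_univ (μ := (volume : Measure ℝ)), Measure.restrict_restrict_of_subset
        (Set.subset_univ _), Measure.prod_restrict]
      refine (ae_restrict_iff' (measurableSet_Ioi.prod MeasurableSet.univ)).2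
        (Filter.Eventually.of_forall ?_)
      rintro ⟨ξ, t⟩ ⟨hξ, -⟩
      have hξ' : (0 : ℝ) < ξ := hξ
      refine le_of_eq ?_
      simp only [Function.uncurry_apply_pair, qexp_sub, norm_mul, norm_pow, Complex.norm_I,
        Complex.norm_real, Real.norm_of_nonneg hξ'.le, Complex.norm_exp]
      simp
      ring

/-- The values of the line moments for nonnegative exponents. -/
def polyMom (a c : ℝ) : ℕ → ℝ
  | 0 => gaussMom a c
  | 1 => -c / (2 * a) * gaussMom a c
  | n + 2 => -(c * polyMom a c (n + 1) + (n + 1) * polyMom a c n) / (2 * a)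

/-- The values of the line moments. -/
def realMom (a c : ℝ) : ℤ → ℝ
  | Int.ofNat n => polyMom a c n
  | Int.negSucc n => (n.factorial : ℝ)⁻¹ * ∫ ξ in Set.Ioi (0 : ℝ), ξ ^ n * gaussMom a (c - ξ)

lemma lineMom_nat {s a : ℝ} (hs : 0 < s) (ha : 0 < a) (c : ℝ) (n : ℕ) :
    lineMom s a c n = polyMom a c n := by
  have ha' : (a : ℂ) ≠ 0 := by exact_mod_cast ha.ne'
  induction n using Nat.strong_induction_on with
  | _ n ih =>
    match n, ih with
    | 0, _ => exact lineMom_zero ha c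
    | 1, ih =>
      have h := lineMom_rec hs ha c 0
      have h0 := lineMom_zero (s := s) ha c
      simp only [polyMom]
      simp only [Int.cast_zero, zero_mul, zero_add, h0] at h
      push_cast
      field_simp
      linear_combination h
    | n + 2, ih =>
      have h := lineMom_rec hs ha c (n + 1)
      have h1 := ih (n + 1) (by omega)
      have h0 := ih n (by omega)
      simp only [polyMom]
      push_cast at h h1 ⊢
      rw [show (n : ℤ) + 1 - 1 = n by ring, show (n : ℤ) + 1 + 1 = n + 2 by ring, h0, h1] at h
      field_simp
      linear_combination h

/-- Nonnegative exponents come from the recurrence, negative ones from the Laplace transform of the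
Gaussian. Since the value does not involve `s`, this also does the work of Cauchy's theorem for
moving the line within the right half-plane. -/
lemma lineMom_eq_realMom {s a : ℝ} (hs : 0 < s) (ha : 0 < a) (c : ℝ) (m : ℤ) :
    lineMom s a c m = realMom a c m := by
  rcases m with n | n
  · exact lineMom_nat hs ha c n
  · have := lineMom_laplace hs ha c 0 n
    simp only [lineMom_zero ha] at this
    rw [Int.negSucc_eq, show -((n : ℤ) + 1) = 0 - (n + 1) by ring, this,
      show (0 : ℤ) - (n + 1) = Int.negSucc n by rw [Int.negSucc_eq]; ring, realMom]
    rw [Complex.ofReal_mul, ← integral_complex_ofReal]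
    push_cast
    rfl

/-! ### Moving the line across the origin -/

lemma gaussMom_neg (a c : ℝ) : gaussMom a (-c) = gaussMom a c := by
  unfold gaussMom; rw [neg_sq]

lemma gaussMom_pos {a : ℝ} (ha : 0 < a) (c : ℝ) : 0 < gaussMom a c := by
  unfold gaussMom
  have := Real.pi_pos
  positivity

lemma continuous_gaussMom (a : ℝ) : Continuous (gaussMom a) := by
  unfold gaussMom; fun_prop

lemma gaussMom_eq (a c : ℝ) :
    gaussMom a c = (2 * Real.sqrt (Real.pi * a))⁻¹ * Real.exp (-(1 / (4 * a)) * c ^ 2) := by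
  unfold gaussMom
  rw [div_eq_inv_mul]
  congr 2
  ring

lemma integrable_gaussMom {a : ℝ} (ha : 0 < a) : Integrable (gaussMom a) := by
  have h : (0 : ℝ) < 1 / (4 * a) := by positivity
  refine ((integrable_exp_neg_mul_sq h).const_mul (2 * Real.sqrt (Real.pi * a))⁻¹).congr
    (Filter.Eventually.of_forall fun c => (gaussMom_eq a c).symm)

lemma integral_gaussMom {a : ℝ} (ha : 0 < a) : ∫ c, gaussMom a c = 1 := by
  simp only [gaussMom_eq, integral_const_mul, integral_gaussian]
  have h : Real.pi / (1 / (4 * a)) = 2 ^ 2 * (Real.pi * a) := by field_simp; ring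
  have h2 : Real.sqrt (Real.pi * a) ≠ 0 := (Real.sqrt_pos.2 (by have := Real.pi_pos; positivity)).ne'
  rw [h, Real.sqrt_mul (x := 2 ^ 2) (by norm_num), Real.sqrt_sq (by norm_num)]
  field_simp

/-- After reflecting the second one, the two half-line integrals add up to the total mass of the
Gaussian. -/
lemma realMom_neg_one_add {a : ℝ} (ha : 0 < a) (c : ℝ) :
    realMom a c (-1) + realMom a (-c) (-1) = 1 := by
  have h1 : ∀ c, realMom a c (-1) = ∫ ξ in Set.Ioi (0 : ℝ), gaussMom a (c - ξ) := fun c => by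
    rw [show (-1 : ℤ) = Int.negSucc 0 from rfl, realMom]
    simp
  have h2 : ∫ ξ in Set.Ioi (0 : ℝ), gaussMom a (-c - ξ)
      = ∫ ξ in Set.Iic (0 : ℝ), gaussMom a (c - ξ) := by
    have := integral_comp_neg_Ioi 0 (fun ξ => gaussMom a (c - ξ))
    rw [neg_zero] at this
    rw [← this]
    refine integral_congr_ae (Filter.Eventually.of_forall fun ξ => ?_)
    simp only
    rw [← gaussMom_neg]
    congr 1
    ring
  have hi : Integrable fun ξ => gaussMom a (c - ξ) := (integrable_gaussMom ha).comp_sub_left c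
  rw [h1, h1, h2, add_comm, intervalIntegral.integral_Iic_add_Ioi hi.integrableOn hi.integrableOn,
    integral_sub_left_eq_self (gaussMom a), integral_gaussMom ha]

/-- The line on the left of the origin is the reflection of the line on the right, and the
difference between the two lines is the circle. -/
lemma lineMom_sub_lineMom_neg {r s a : ℝ} (hr : 0 < r) (hs : 0 < s) (ha : 0 < a) (c : ℝ) (m : ℤ) :
    lineMom s a c m - (-1) ^ m * lineMom s a (-c) m = circMom r a c m := by
  set T : ℤ → ℂ := fun m =>
    lineMom s a c m - (-1) ^ m * lineMom s a (-c) m - circMom r a c m with hT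
  have ha' : (a : ℂ) ≠ 0 := by exact_mod_cast ha.ne'
  -- All three terms satisfy the same recurrence, so `T` vanishes everywhere once it does at `0` and
  -- `-1`. The value at `-1` must be checked separately: at `m = 0` the coefficient of `T (m - 1)`
  -- is zero.
  have hrec : ∀ m : ℤ, m * T (m - 1) + 2 * a * T (m + 1) + c * T m = 0 := fun m => by
    have h1 := lineMom_rec hs ha c m
    have h2 := lineMom_rec hs ha (-c) m
    have h3 := circMom_rec hr a c m
    simp only [hT, zpow_add_one₀ (show (-1 : ℂ) ≠ 0 by norm_num),
      zpow_sub_one₀ (show (-1 : ℂ) ≠ 0 by norm_num)]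
    push_cast at h2
    rw [show (-1 : ℂ)⁻¹ = -1 by norm_num]
    linear_combination h1 + (-1) ^ m * h2 - h3
  have h0 : T 0 = 0 := by
    simp [hT, lineMom_zero ha, gaussMom_neg, circMom_of_nonneg hr]
  have h1 : T (-1) = 0 := by
    have h := realMom_neg_one_add ha c
    simp only [hT, lineMom_eq_realMom hs ha, circMom_neg_one hr, zpow_neg_one]
    rw [show (-1 : ℂ)⁻¹ = -1 by norm_num]
    have h' : ((realMom a c (-1) + realMom a (-c) (-1) : ℝ) : ℂ) = 1 := by rw [h]; simp
    push_cast at h'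
    linear_combination h'
  have hnat : ∀ n : ℕ, T n = 0 ∧ T (n + 1) = 0 := by
    intro n
    induction n with
    | zero =>
      refine ⟨h0, ?_⟩
      have := hrec 0
      simp only [Int.cast_zero, zero_mul, h0, mul_zero, add_zero, zero_add] at this
      simpa [ha'] using this
    | succ n ih =>
      refine ⟨by simpa using ih.2, ?_⟩
      have := hrec (n + 1)
      rw [ih.2, show (n : ℤ) + 1 - 1 = n by ring, ih.1] at this
      simp only [mul_zero, add_zero, zero_add] at this
      simpa [ha'] using this
  have hneg : ∀ n : ℕ, T (-n) = 0 ∧ T (-n - 1) = 0 := by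
    intro n
    induction n with
    | zero => exact ⟨by simpa using h0, by simpa using h1⟩
    | succ n ih =>
      have e : (-((n + 1 : ℕ) : ℤ)) = -n - 1 := by push_cast; ring
      refine ⟨by rw [e]; exact ih.2, ?_⟩
      have := hrec (-n - 1)
      rw [ih.2, show -(n : ℤ) - 1 + 1 = -n by ring, ih.1] at this
      simp only [mul_zero, add_zero] at this
      rw [e]
      refine (mul_eq_zero.1 this).resolve_left ?_
      push_cast
      norm_cast
      omega
  have : T m = 0 := by
    obtain ⟨n, rfl | rfl⟩ := m.eq_nat_or_neg
    · exact (hnat n).1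
    · exact (hneg n).1
  exact sub_eq_zero.1 this

/-! ### Identification of `Phi` -/

lemma derivative_hermite_succ (n : ℕ) :
    Polynomial.derivative (Polynomial.hermite (n + 1)) = (n + 1) * Polynomial.hermite n := by
  induction n with
  | zero => simp
  | succ n ih =>
    rw [Polynomial.hermite_succ (n + 1), Polynomial.derivative_sub, Polynomial.derivative_mul, ih]
    have h : Polynomial.derivative ((n + 1 : Polynomial ℤ) * Polynomial.hermite n)
        = (n + 1) * Polynomial.derivative (Polynomial.hermite n) := by
      rw [Polynomial.derivative_mul]
      simp
    rw [h, Polynomial.derivative_X, Polynomial.hermite_succ n]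
    push_cast
    ring

lemma hermiteH_add_two (n : ℕ) (x : ℝ) :
    hermiteH (n + 2) x = 2 * x * hermiteH (n + 1) x - 2 * (n + 1) * hermiteH n x := by
  unfold hermiteH
  rw [Polynomial.hermite_succ (n + 1), derivative_hermite_succ]
  have h2 : Real.sqrt 2 ^ 2 = 2 := Real.sq_sqrt (by norm_num)
  have hc : Polynomial.aeval (Real.sqrt 2 * x) ((n : Polynomial ℤ) + 1) = (n : ℝ) + 1 := by simp
  simp only [map_sub, map_mul, hc, Polynomial.aeval_X]
  linear_combination Real.sqrt 2 ^ n * (Real.sqrt 2 * x *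
    Polynomial.aeval (Real.sqrt 2 * x) (Polynomial.hermite (n + 1))
    - (n + 1) * Polynomial.aeval (Real.sqrt 2 * x) (Polynomial.hermite n)) * h2

lemma gaussMom_one_two_mul (η : ℝ) : gaussMom 1 (2 * η) = gauss η / 2 := by
  unfold gaussMom gauss
  rw [mul_one, mul_one, show -(2 * η) ^ 2 / 4 = -η ^ 2 by ring]
  ring

/-- Both sides satisfy the Hermite three-term recurrence with the same first two values. -/
lemma Phi_negSucc (n : ℕ) (η : ℝ) : Phi (Int.negSucc n) η = polyMom 1 (2 * η) n := by
  induction n using Nat.strong_induction_on with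
  | _ n ih =>
    match n, ih with
    | 0, _ =>
      rw [Phi, polyMom, gaussMom_one_two_mul]
      simp [hermiteH, gauss]
      ring
    | 1, _ =>
      rw [Phi, polyMom, gaussMom_one_two_mul]
      simp only [hermiteH, gauss, Polynomial.hermite_one, Polynomial.aeval_X, pow_one]
      have h2 : Real.sqrt 2 * Real.sqrt 2 = 2 := Real.mul_self_sqrt (by norm_num)
      linear_combination (-η) * Real.exp (-η ^ 2) / Real.sqrt Real.pi / 4 * h2
    | n + 2, ih =>
      have h1 := ih (n + 1) (by omega)
      have h0 := ih n (by omega)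
      rw [polyMom, ← h1, ← h0, Phi, Phi, Phi, hermiteH_add_two]
      field_simp
      ring

/-- For `n ≥ 0` this is the Laplace form of the moment after rescaling `ξ` by `2`; for `n < 0` it is
the Hermite case. Both branches of `Phi` thus belong to one family of contour moments. -/
lemma Phi_eq_realMom (n : ℤ) (η : ℝ) : Phi n η = realMom 1 (2 * η) (-n - 1) := by
  rcases n with n | n
  · rw [show -(Int.ofNat n) - 1 = Int.negSucc n by rw [Int.negSucc_eq]; simp; ring, Phi, realMom]
    have h := integral_comp_mul_left_Ioi (fun ξ => ξ ^ n * gaussMom 1 (2 * η - ξ)) 0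
      (show (0 : ℝ) < 2 by norm_num)
    rw [mul_zero] at h
    have h' : ∫ ξ in Set.Ioi (0 : ℝ), (2 * ξ) ^ n * gaussMom 1 (2 * η - 2 * ξ)
        = 2 ^ n / (2 * Real.sqrt Real.pi)
          * ∫ ξ in Set.Ioi (0 : ℝ), ξ ^ n * Real.exp (-(ξ - η) ^ 2) := by
      rw [← integral_const_mul]
      refine integral_congr_ae (Filter.Eventually.of_forall fun ξ => ?_)
      simp only
      rw [← mul_sub, gaussMom_one_two_mul, gauss, mul_pow,
        show -(η - ξ) ^ 2 = -(ξ - η) ^ 2 by ring]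
      ring
    rw [h', smul_eq_mul] at h
    have h3 : ∫ ξ in Set.Ioi (0 : ℝ), ξ ^ n * gaussMom 1 (2 * η - ξ)
        = 2 * (2 ^ n / (2 * Real.sqrt Real.pi)
          * ∫ ξ in Set.Ioi (0 : ℝ), ξ ^ n * Real.exp (-(ξ - η) ^ 2)) := by
      rw [h]; ring
    rw [h3]
    have : Real.sqrt Real.pi ≠ 0 := by have := Real.pi_pos; positivity
    field_simp
  · rw [Phi_negSucc, show -(Int.negSucc n) - 1 = Int.ofNat n by rw [Int.negSucc_eq]; simp, realMom]

lemma lineMom_one {s : ℝ} (hs : 0 < s) (η : ℝ) (m : ℤ) :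
    lineMom s 1 (2 * η) m = Phi (-m - 1) η := by
  rw [lineMom_eq_realMom hs one_pos, Phi_eq_realMom]
  congr 2
  ring

/-! ### Leading coefficients -/

/-- `f` is a polynomial function of degree at most `n`, with coefficient `t` at `z^n`. -/
def IsPolyLead (n : ℕ) (t : ℝ) (f : ℝ → ℝ) : Prop :=
  ∃ P : Polynomial ℝ, P.natDegree ≤ n ∧ P.coeff n = t ∧ ∀ z, f z = P.eval z

lemma IsPolyLead.const (t : ℝ) : IsPolyLead 0 t fun _ => t :=
  ⟨Polynomial.C t, by simp, by simp, by simp⟩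

lemma IsPolyLead.linear (p q : ℝ) : IsPolyLead 1 p fun z => p * z + q :=
  ⟨Polynomial.C p * Polynomial.X + Polynomial.C q, Polynomial.natDegree_linear_le, by simp
    [Polynomial.coeff_C], by simp⟩

lemma IsPolyLead.const_mul {n : ℕ} {t : ℝ} {f : ℝ → ℝ} (h : IsPolyLead n t f) (b : ℝ) :
    IsPolyLead n (b * t) fun z => b * f z := by
  obtain ⟨P, hd, hc, he⟩ := h
  exact ⟨Polynomial.C b * P, (Polynomial.natDegree_C_mul_le _ _).trans hd, by simp [hc],
    fun z => by simp [he]⟩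

lemma IsPolyLead.linear_mul_add {n : ℕ} {t t' : ℝ} {f g : ℝ → ℝ} (hf : IsPolyLead (n + 1) t f)
    (hg : IsPolyLead n t' g) (p q d : ℝ) :
    IsPolyLead (n + 2) (p * t) fun z => (p * z + q) * f z + d * g z := by
  obtain ⟨P, hd, hc, he⟩ := hf
  obtain ⟨Q, hd', hc', he'⟩ := hg
  refine ⟨(Polynomial.C p * Polynomial.X + Polynomial.C q) * P + Polynomial.C d * Q, ?_, ?_, ?_⟩
  · refine Polynomial.natDegree_add_le_of_degree_le ?_ ?_
    · have := Polynomial.natDegree_mul_le_of_le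
        (Polynomial.natDegree_linear_le (a := p) (b := q)) hd
      omega
    · exact (Polynomial.natDegree_C_mul_le _ _).trans (by omega)
  · have h1 : P.coeff (n + 2) = 0 := Polynomial.coeff_eq_zero_of_natDegree_lt (by omega)
    have h2 : Q.coeff (n + 2) = 0 := Polynomial.coeff_eq_zero_of_natDegree_lt (by omega)
    rw [add_mul, mul_assoc]
    simp [h1, h2, hc, Polynomial.coeff_X_mul]
  · intro z
    simp [he, he']

/-- Each step of the recurrence multiplies the leading coefficient by `-p / (2 * a)`; the other
terms have lower degree. -/
lemma exists_isPolyLead_polyMom {a : ℝ} (p q : ℝ) (n : ℕ) :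
    ∃ f, IsPolyLead n ((-p / (2 * a)) ^ n) f ∧
      ∀ z, polyMom a (p * z + q) n = gaussMom a (p * z + q) * f z := by
  induction n using Nat.strong_induction_on with
  | _ n ih =>
    match n, ih with
    | 0, _ => exact ⟨_, by simpa using IsPolyLead.const 1, fun z => by simp [polyMom]⟩
    | 1, _ =>
      refine ⟨_, by simpa using IsPolyLead.linear (-p / (2 * a)) (-q / (2 * a)), fun z => ?_⟩
      rw [polyMom]; ring
    | n + 2, ih =>
      obtain ⟨f, hf, hf'⟩ := ih (n + 1) (by omega)
      obtain ⟨g, hg, hg'⟩ := ih n (by omega)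
      refine ⟨_, by
        have := hf.linear_mul_add hg (-p / (2 * a)) (-q / (2 * a)) (-(n + 1) / (2 * a))
        rwa [← pow_succ'] at this, fun z => ?_⟩
      simp only [polyMom, hf', hg']
      ring

/-- The moment is the `w^n` coefficient of `exp (a w² + (p z + q) w)`; its top degree in `z` comes
from the linear term alone, whence `p^n / n!`. -/
lemma exists_isPolyLead_circMom {r : ℝ} (hr : 0 < r) (a p q : ℝ) (n : ℕ) :
    ∃ f, IsPolyLead n (p ^ n / n.factorial) f ∧
      ∀ z : ℝ, circMom r a (p * z + q : ℝ) (-n - 1) = (f z : ℂ) := by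
  induction n using Nat.strong_induction_on with
  | _ n ih =>
    match n, ih with
    | 0, _ =>
      exact ⟨_, by simpa using IsPolyLead.const 1, fun z => by simp [circMom_neg_one hr]⟩
    | 1, _ =>
      refine ⟨_, by simpa using IsPolyLead.linear p q, fun z => ?_⟩
      have h := circMom_rec hr a (p * z + q : ℝ) (-1)
      rw [circMom_neg_one hr, circMom_of_nonneg hr _ _ (m := -1 + 1) (by norm_num)] at h
      push_cast at h ⊢
      linear_combination -h
    | n + 2, ih =>
      obtain ⟨f, hf, hf'⟩ := ih (n + 1) (by omega)
      obtain ⟨g, hg, hg'⟩ := ih n (by omega)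
      have hn : (n : ℝ) + 2 ≠ 0 := by positivity
      refine ⟨_, by
        have := hf.linear_mul_add hg (p / (n + 2)) (q / (n + 2)) (2 * a / (n + 2))
        convert this using 1
        rw [Nat.factorial_succ (n + 1)]
        push_cast
        field_simp
        ring, fun z => ?_⟩
      have h := circMom_rec hr a (p * z + q : ℝ) (-(n + 2))
      have h1 := hf' z
      have h2 := hg' z
      push_cast at h h1 h2 ⊢
      rw [show -((n : ℤ) + 2) + 1 = -n - 1 by ring, h2,
        show -((n : ℤ) + 2) = -(n + 1) - 1 by ring, h1] at h
      rw [show -((n : ℤ) + 2) - 1 = -(n + 1) - 1 - 1 by ring]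
      have hn' : (n : ℂ) + 2 ≠ 0 := by exact_mod_cast hn
      field_simp
      linear_combination -h

/-! ### The kernels as finite sums of moments -/

/-- The number `m` of terms is left free so that different kernels can be expanded to a common
length. -/
lemma circleInt_lineInt_qexp {r s : ℝ} (hr : 0 < r) (hrs : r < s) (a₁ c₁ : ℂ) {a₂ : ℝ}
    (ha : 0 < a₂) (c₂ : ℝ) {ν : ℤ} (μ : ℤ) {m : ℕ} (hm : 0 ≤ ν + m) :
    circleInt r (fun z => lineInt s fun w =>
        1 / (w - z) * (z ^ ν * qexp a₁ c₁ z * (w ^ μ * qexp a₂ c₂ w)))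
      = ∑ k ∈ Finset.range m, circMom r a₁ c₁ (ν + k) * lineMom s a₂ c₂ (μ - k - 1) := by
  have hs := hr.trans hrs
  rw [circleInt_lineInt_eq_sum hr hrs (differentiable_qexp a₁ c₁) hm
    (continuous_line_zpow_mul hs μ (continuous_qexp _ _)) fun k => ?_]
  · refine Finset.sum_congr rfl fun k _ => ?_
    congr 1
    refine lineInt_congr fun t => ?_
    rw [← mul_assoc, ← zpow_add₀ (line_ne_zero hs t)]
    congr 2
    ring
  · refine (integrable_line hs ha c₂ (μ - k)).congr (Filter.Eventually.of_forall fun t => ?_)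
    simp only
    rw [← mul_assoc, ← zpow_add₀ (line_ne_zero hs t)]
    congr 2
    ring

lemma kernelK_eq_sum {r s : ℝ} (hr : 0 < r) (hrs : r < s) (β : ℝ) (l : ℤ) {k : ℤ} {m : ℕ} (hm : 0 ≤ k + m) :
    kernelK r s β l k = ∑ j ∈ Finset.range m,
      circMom r (-2) (4 * β) (k + j) * lineMom s 2 (-4 * β) (-l - j - 2) := by
  unfold kernelK
  have h := circleInt_lineInt_qexp hr hrs (-2) (4 * β) two_pos (-4 * β) (-(l + 1)) hm
  simp only [show ∀ j : ℕ, -(l + 1) - (j : ℤ) - 1 = -l - j - 2 by intro j; ring] at h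
  rw [← h]
  congr 1; funext z; congr 1; funext w
  rw [zpow_neg, div_eq_mul_inv (Complex.exp _), ← Complex.exp_neg, qexp, qexp]
  push_cast
  ring_nf

/-- For `k ≥ 0` nothing is singular inside the circle. Hence only the columns `-ρ, …, -1` of `𝒦`
survive, and `1 - 𝒦` is governed by finite matrices. -/
lemma kernelK_of_nonneg {r s : ℝ} (hr : 0 < r) (hrs : r < s) (β : ℝ) (l : ℤ) {k : ℤ} (hk : 0 ≤ k) : kernelK r s β l k = 0 := by
  rw [kernelK_eq_sum hr hrs β l (m := 0) (by simpa using hk)]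
  simp

lemma funA_eq_sum {r s : ℝ} (hr : 0 < r) (hrs : r < s) (β : ℝ) {v : ℤ} (y : ℝ) (k : ℤ) {m : ℕ} (hm : 0 ≤ -v + m) :
    funA r s β v y k = -(∑ j ∈ Finset.range m,
      circMom r (-1) (-2 * y) (-v + j) * lineMom s 2 (-4 * β) (-k - j - 2))
      + lineMom s 1 (-2 * (y + 2 * β)) (-v - k - 1) := by
  unfold funA
  have h := circleInt_lineInt_qexp hr hrs (-1) (-2 * y) two_pos (-4 * β) (-(k + 1)) hm
  simp only [show ∀ j : ℕ, -(k + 1) - (j : ℤ) - 1 = -k - j - 2 by intro j; ring] at h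
  rw [← h]
  congr 1
  · rw [neg_eq_neg_one_mul (circleInt _ _), ← circleInt_const_mul]
    congr 1; funext z
    rw [← lineInt_const_mul]
    congr 1; funext w
    rw [zpow_neg w, div_eq_mul_inv (Complex.exp _), ← Complex.exp_neg, qexp, qexp,
      ← neg_sub w z, one_div, inv_neg]
    push_cast
    ring_nf
  · unfold lineMom
    congr 1; funext w
    rw [show -v - k - 1 = -(v + k + 1) by ring, zpow_neg, qexp, div_eq_inv_mul]
    push_cast
    ring_nf

lemma funB_eq_sum {r s : ℝ} (hr : 0 < r) (hrs : r < s) (β : ℝ) (u : ℤ) (y : ℝ) {l : ℤ} {m : ℕ} (hm : 0 ≤ l + m) :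
    funB r s β u y l = -(∑ j ∈ Finset.range m,
      circMom r (-2) (4 * β) (l + j) * lineMom s 1 (2 * y) (u - j - 1))
      + circMom r (-1) (2 * (y + 2 * β)) (u + l) := by
  unfold funB
  have h := circleInt_lineInt_qexp hr hrs (-2) (4 * β) one_pos (2 * y) u hm
  rw [← h]
  congr 1
  · rw [neg_eq_neg_one_mul (circleInt _ _), ← circleInt_const_mul]
    congr 1; funext z
    rw [← lineInt_const_mul]
    congr 1; funext w
    rw [zpow_neg w, div_eq_mul_inv (Complex.exp _), ← Complex.exp_neg, qexp, qexp,
      ← neg_sub w z, one_div, inv_neg, div_inv_eq_mul]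
    push_cast
    ring_nf
  · unfold circMom
    congr 1; funext w
    rw [qexp, div_eq_mul_inv, ← Complex.exp_neg]
    ring_nf

lemma minorKernel_self_eq_sum {r s : ℝ} (hr : 0 < r) (hrs : r < s) {u : ℤ} (x x' : ℝ) {m : ℕ} (hm : 0 ≤ -u + m) :
    minorKernel r s u x u x' = 2 * ∑ j ∈ Finset.range m,
      circMom r (-1) (2 * x) (-u + j) * lineMom s 1 (-2 * x') (u - j - 1) := by
  unfold minorKernel
  have h := circleInt_lineInt_qexp hr hrs (-1) (2 * x) one_pos (-2 * x') u hm
  rw [← h, if_neg (lt_irrefl u), neg_zero, zero_add]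
  congr 2; funext z; congr 1; funext w
  rw [zpow_neg z, div_eq_mul_inv (Complex.exp _), ← Complex.exp_neg, qexp, qexp]
  push_cast
  ring_nf

/-! ### Decay -/

/-- Bounded by a multiple of `2^{-i}`. -/
def GeomDecay (f : ℕ → ℂ) : Prop := ∃ C : ℝ, ∀ i, ‖f i‖ ≤ C * (1 / 2) ^ i

lemma GeomDecay.add {f g : ℕ → ℂ} (hf : GeomDecay f) (hg : GeomDecay g) :
    GeomDecay fun i => f i + g i := by
  obtain ⟨C, hC⟩ := hf
  obtain ⟨C', hC'⟩ := hg
  exact ⟨C + C', fun i => (norm_add_le _ _).trans (by rw [add_mul]; exact add_le_add (hC i) (hC' i))⟩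

lemma GeomDecay.const_mul {f : ℕ → ℂ} (hf : GeomDecay f) (b : ℂ) : GeomDecay fun i => b * f i := by
  obtain ⟨C, hC⟩ := hf
  exact ⟨‖b‖ * C, fun i => by rw [norm_mul, mul_assoc]; gcongr; exact hC i⟩

lemma GeomDecay.sum {ι : Type*} (S : Finset ι) {f : ι → ℕ → ℂ} (hf : ∀ j ∈ S, GeomDecay (f j)) :
    GeomDecay fun i => ∑ j ∈ S, f j i := by
  classical
  induction S using Finset.induction_on with
  | empty => exact ⟨0, fun i => by simp⟩
  | insert a S ha ih =>
    simp only [Finset.sum_insert ha]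
    exact (hf a (by simp)).add (ih fun j hj => hf j (by simp [hj]))

lemma GeomDecay.summable_sq {f : ℕ → ℂ} (hf : GeomDecay f) : Summable fun i => ‖f i‖ ^ 2 := by
  obtain ⟨C, hC⟩ := hf
  refine Summable.of_nonneg_of_le (fun i => by positivity) (fun i => ?_)
    ((summable_geometric_of_lt_one (r := (1 / 2 : ℝ) ^ 2) (by norm_num) (by norm_num)).mul_left
      (C ^ 2))
  calc _ ≤ (C * (1 / 2) ^ i) ^ 2 := by gcongr; exact hC i
    _ = _ := by rw [mul_pow, ← pow_mul, ← pow_mul, mul_comm i]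

lemma geomDecay_lineMom {s a : ℝ} (hs : 0 < s) (ha : 0 < a) (c : ℝ) (p : ℤ) :
    GeomDecay fun i => lineMom s a c (p - i) := by
  -- The line is moved to abscissa `2`, where `|w| ≥ 2` yields the ratio `1/2`; the given `s` may be
  -- less than `1`.
  have h2 : (0 : ℝ) < 2 := two_pos
  refine ⟨‖(2 * Real.pi * Complex.I : ℂ)⁻¹‖ * ∫ t : ℝ,
    ‖(((2 : ℝ) + t * Complex.I : ℂ) ^ p * qexp a c ((2 : ℝ) + t * Complex.I))‖, fun i => ?_⟩
  simp only
  rw [lineMom_eq_realMom hs ha, ← lineMom_eq_realMom h2 ha]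
  unfold lineMom lineInt
  rw [norm_mul, mul_assoc ‖(2 * Real.pi * Complex.I : ℂ)⁻¹‖, ← integral_mul_const]
  refine mul_le_mul_of_nonneg_left ?_ (norm_nonneg _)
  refine norm_integral_le_of_norm_le ((integrable_line h2 ha c p).norm.mul_const _)
    (Filter.Eventually.of_forall fun t => ?_)
  have hw := line_ne_zero h2 t
  have hn := le_norm_line 2 t
  simp only
  rw [zpow_sub₀ hw, zpow_natCast, norm_mul, norm_mul, Complex.norm_I, mul_one, norm_div, norm_mul,
    norm_pow, one_div, inv_pow, div_eq_mul_inv]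
  have : (‖((2 : ℝ) + t * Complex.I : ℂ)‖ ^ i)⁻¹ ≤ (2 ^ i)⁻¹ :=
    inv_anti₀ (by positivity) (by gcongr)
  calc _ = ‖((2 : ℝ) + t * Complex.I : ℂ) ^ p‖ * ‖qexp a c ((2 : ℝ) + t * Complex.I)‖
        * (‖((2 : ℝ) + t * Complex.I : ℂ)‖ ^ i)⁻¹ := by ring
    _ ≤ _ := by gcongr

lemma geomDecay_kernelK {r s : ℝ} (hr : 0 < r) (hrs : r < s) (β : ℝ) (ρ : ℕ) (k : ℤ) : GeomDecay fun i => kernelK r s β (i - ρ) k := by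
  have hm : 0 ≤ k + (-k).toNat := by omega
  simp only [kernelK_eq_sum hr hrs β _ hm]
  refine GeomDecay.sum _ fun j _ => GeomDecay.const_mul ?_ _
  have := geomDecay_lineMom (hr.trans hrs) two_pos (-4 * β) (ρ - j - 2)
  convert this using 3
  ring

lemma geomDecay_funA {r s : ℝ} (hr : 0 < r) (hrs : r < s) (β : ℝ) (ρ : ℕ) (v : ℤ) (y : ℝ) : GeomDecay fun i => funA r s β v y (i - ρ) := by
  have hm : 0 ≤ -v + v.toNat := by omega
  simp only [funA_eq_sum hr hrs β y _ hm, neg_eq_neg_one_mul (Finset.sum _ _)]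
  refine (GeomDecay.const_mul (GeomDecay.sum _ fun j _ => GeomDecay.const_mul ?_ _) _).add ?_
  · have := geomDecay_lineMom (hr.trans hrs) two_pos (-4 * β) (ρ - j - 2)
    convert this using 3
    ring
  · have := geomDecay_lineMom (hr.trans hrs) one_pos (-2 * (y + 2 * β)) (-v + ρ - 1)
    convert this using 3
    ring

/-! ### The resolvent -/

/-- The block of `𝒦^β` with indices `-ρ, …, -1`. -/
def finiteK (r s β : ℝ) (ρ : ℕ) : Matrix (Fin ρ) (Fin ρ) ℂ :=
  Matrix.of fun i j : Fin ρ => kernelK r s β ((i : ℕ) - ρ) ((j : ℕ) - ρ)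

lemma fredholmDet_eq (r s β : ℝ) (ρ : ℕ) : fredholmDet r s β ρ = (1 - finiteK r s β ρ).det := by
  rw [← Matrix.det_submatrix_equiv_self Fin.revPerm (1 - finiteK r s β ρ), fredholmDet]
  congr 1
  ext i j
  have h : ∀ i : Fin ρ, (-1 - ((i : ℕ) : ℤ)) = ((Fin.rev i : Fin ρ) : ℕ) - (ρ : ℤ) := fun i => by
    rw [Fin.val_rev]
    omega
  simp only [Matrix.sub_apply, Matrix.submatrix_apply, Matrix.of_apply, finiteK, Fin.revPerm_apply,
    Matrix.one_apply, h, Fin.rev_inj]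

lemma hasSum_kernelK_iff {r s : ℝ} (hr : 0 < r) (hrs : r < s) (β : ℝ) (ρ : ℕ) (l : ℤ) (g : ℕ → ℂ) (S : ℂ) :
    HasSum (fun j : ℕ => kernelK r s β l ((j : ℤ) - ρ) * g j) S
      ↔ S = ∑ j ∈ Finset.range ρ, kernelK r s β l ((j : ℤ) - ρ) * g j := by
  have h : HasSum (fun j : ℕ => kernelK r s β l ((j : ℤ) - ρ) * g j)
      (∑ j ∈ Finset.range ρ, kernelK r s β l ((j : ℤ) - ρ) * g j) := by
    refine hasSum_sum_of_ne_finset_zero fun j hj => ?_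
    rw [Finset.mem_range, not_lt] at hj
    rw [kernelK_of_nonneg hr hrs β l (by omega), zero_mul]
  exact ⟨fun h' => h'.unique h, fun h' => h' ▸ h⟩

/-- A solution is determined by its first `ρ` entries: these solve a finite system with matrix `1 -
finiteK`, and the equation then gives the others explicitly. Decay of the columns of `𝒦` keeps the
result square summable. -/
lemma existsUnique_isResolventSolution {r s : ℝ} (hr : 0 < r) (hrs : r < s) (β : ℝ) {ρ : ℕ} (hD : fredholmDet r s β ρ ≠ 0) {a : ℕ → ℂ}
    (ha : Summable fun i => ‖a i‖ ^ 2) : ∃! g : ℕ → ℂ, IsResolventSolution r s β ρ a g := by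
  rw [fredholmDet_eq] at hD
  have hu : IsUnit (1 - finiteK r s β ρ).det := isUnit_iff_ne_zero.2 hD
  set v : Fin ρ → ℂ := (1 - finiteK r s β ρ)⁻¹.mulVec fun i => a i with hv
  have hv' : (1 - finiteK r s β ρ).mulVec v = fun i : Fin ρ => a i := by
    rw [hv, Matrix.mulVec_mulVec, Matrix.mul_nonsing_inv _ hu, Matrix.one_mulVec]
  set g : ℕ → ℂ := fun i => a i + ∑ j : Fin ρ, kernelK r s β ((i : ℤ) - ρ) ((j : ℕ) - ρ) * v j
    with hg
  have hgv : ∀ i : Fin ρ, g i = v i := fun i => by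
    have := congrFun hv' i
    rw [Matrix.sub_mulVec, Matrix.one_mulVec, Pi.sub_apply] at this
    rw [hg]
    simp only
    rw [← this]
    simp [Matrix.mulVec, dotProduct, finiteK]
  refine ⟨g, ⟨?_, fun i => ?_⟩, fun g' hg' => ?_⟩
  · have h1 : GeomDecay fun i : ℕ =>
        ∑ j : Fin ρ, kernelK r s β ((i : ℤ) - ρ) ((j : ℕ) - ρ) * v j := by
      refine GeomDecay.sum _ fun j _ => ?_
      simp only [mul_comm _ (v j)]
      exact (geomDecay_kernelK hr hrs β ρ _).const_mul _
    refine Summable.of_nonneg_of_le (fun i => by positivity) (fun i => ?_)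
      ((ha.mul_left 2).add (h1.summable_sq.mul_left 2))
    have h2 := norm_add_le (a i) (∑ j : Fin ρ, kernelK r s β ((i : ℤ) - ρ) ((j : ℕ) - ρ) * v j)
    have h3 := norm_nonneg (a i + ∑ j : Fin ρ, kernelK r s β ((i : ℤ) - ρ) ((j : ℕ) - ρ) * v j)
    refine (pow_le_pow_left₀ h3 h2 2).trans ?_
    nlinarith [sq_nonneg (‖a i‖ - ‖∑ j : Fin ρ, kernelK r s β ((i : ℤ) - ρ) ((j : ℕ) - ρ) * v j‖)]
  · rw [hasSum_kernelK_iff hr hrs, ← Fin.sum_univ_eq_sum_range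
      (fun j => kernelK r s β ((i : ℤ) - ρ) ((j : ℤ) - ρ) * g j)]
    simp only [hgv]
    rw [hg]
    simp
  · have h := fun i => (hasSum_kernelK_iff hr hrs β ρ _ g' _).1 (hg'.2 i)
    simp only [← Fin.sum_univ_eq_sum_range
      (fun j => kernelK r s β _ ((j : ℤ) - ρ) * g' j)] at h
    have hv'' : (fun i : Fin ρ => g' i) = v := by
      have : (1 - finiteK r s β ρ).mulVec (fun i : Fin ρ => g' i) = fun i : Fin ρ => a i := by
        funext i
        rw [Matrix.sub_mulVec, Matrix.one_mulVec, Pi.sub_apply]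
        have := h i
        simp only [Matrix.mulVec, dotProduct, finiteK, Matrix.of_apply]
        rw [← this]
        ring
      rw [hv, ← this, Matrix.mulVec_mulVec, Matrix.nonsing_inv_mul _ hu, Matrix.one_mulVec]
    funext i
    have := h i
    rw [hg]
    simp only [← hv'']
    rw [← this]
    ring

/-! ### One-level factorization of the kernel

The index set is `{-M, …, P - 1}` with `M = a + ρ ≥ u` and `P = max (-u) 0`. -/

/-- The moments `(2πi)⁻¹ ∮ e^{w² - 2w(z+β)} w^{-u-l-1} dw`. -/
def cMom (r β : ℝ) (u : ℤ) (z : ℝ) (l : ℤ) : ℂ := circMom r 1 (-2 * (z + β)) (-u - l - 1)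

/-- The entry at `l` of `(1 - 𝒦) G`, for the left factor `G` of the kernel. -/
def leftRow (r s β : ℝ) (ρ : ℕ) (u : ℤ) (z : ℝ) (l : ℤ) : ℂ :=
  (if -(ρ : ℤ) ≤ l then lineMom s 1 (-2 * (z + β)) (-u - l - 1) else 0) - cMom r β u z l

/-- The unipotent reduction of the right factor `ℬ` of the kernel. -/
def rightRow (r s β : ℝ) (u : ℤ) (z : ℝ) (l : ℤ) : ℂ :=
  circMom r 1 (2 * (z - β)) (u + l) - if l < 0 then lineMom s 1 (2 * (z - β)) (u + l) else 0

lemma cMom_eq_zero {r : ℝ} (hr : 0 < r) (β : ℝ) {u : ℤ} (z : ℝ) {l : ℤ} (h : u + l < 0) :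
    cMom r β u z l = 0 :=
  circMom_of_nonneg hr _ _ (by omega)

/-- Convolution adds the quadratic parameters `1` and `-2`, and the linear ones to `-2 (z - β)`. For
`u ≤ 0` both sides vanish; for `u > 0` only the last `u` indices contribute. -/
lemma sum_cMom_mul {r : ℝ} (hr : 0 < r) (β : ℝ) {u : ℤ} {M P : ℕ} (hM : u ≤ M)
    (hP : (P : ℤ) = max (-u) 0) (z : ℝ) (k : ℕ) :
    ∑ i ∈ Finset.range (M + P), cMom r β u z (i - M) * circMom r (-2) (4 * β) (i - M + k)
      = circMom r (-1) (-2 * (z - β)) (-u + k) := by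
  rcases le_or_gt u 0 with hu | hu
  · rw [circMom_of_nonneg hr (-1) _ (by omega), Finset.sum_eq_zero]
    intro i hi
    rw [Finset.mem_range] at hi
    rw [cMom_eq_zero hr β z (by omega), zero_mul]
  · obtain ⟨n, rfl⟩ := Int.eq_ofNat_of_zero_le hu.le
    have hP0 : P = 0 := by omega
    obtain ⟨b, rfl⟩ : ∃ b, M = b + n := ⟨M - n, by omega⟩
    subst hP0
    have h := circMom_add hr 1 (-2 * (z + β)) (-2) (4 * β) (N := -(n : ℤ) + k) (n := n) (by omega)
    rw [show (1 + -2 : ℂ) = -1 by norm_num, show (-2 * (z + β) + 4 * β : ℂ) = -2 * (z - β) by ring]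
      at h
    rw [h, add_zero, Finset.sum_range_add, Finset.sum_eq_zero, zero_add]
    · refine Finset.sum_congr rfl fun j _ => ?_
      unfold cMom
      congr 2 <;> push_cast <;> ring
    · intro i hi
      rw [Finset.mem_range] at hi
      rw [cMom_eq_zero hr β z (by push_cast; omega), zero_mul]

lemma funB_level {r s : ℝ} (hr : 0 < r) (hrs : r < s) (β : ℝ) (u : ℤ) {M : ℕ} (z : ℝ) {l : ℤ}
    (hl : -(M : ℤ) ≤ l) :
    funB r s β u (z - β) l = -(∑ k ∈ Finset.range M,
      circMom r (-2) (4 * β) (l + k) * lineMom s 1 (2 * (z - β)) (u - k - 1))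
      + circMom r (-1) (2 * (z + β)) (u + l) := by
  rw [funB_eq_sum hr hrs β u (z - β) (m := M) (by omega)]
  congr 2
  push_cast
  ring

/-- The circle part of `ℬ` does not meet `cMom`: one vanishes for `u + l ≥ 0`, the other for `u + l
< 0`. In the remaining double integral, summation against `cMom` turns the circle weight into that
of the minor kernel. -/
lemma minorKernel_level {r s : ℝ} (hr : 0 < r) (hrs : r < s) (β : ℝ) {u : ℤ} {M P : ℕ}
    (hM : u ≤ M) (hP : (P : ℤ) = max (-u) 0) (z₁ z₂ : ℝ) :
    minorKernel r s u (β - z₁) u (β - z₂) = -2 * ∑ i ∈ Finset.range (M + P),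
      cMom r β u z₁ (i - M) * funB r s β u (z₂ - β) (i - M) := by
  rw [minorKernel_self_eq_sum hr hrs (m := M) _ _ (by omega)]
  have h1 : ∀ k : ℕ, circMom r (-1) (2 * ((β - z₁ : ℝ) : ℂ)) (-u + k)
      = ∑ i ∈ Finset.range (M + P), cMom r β u z₁ (i - M) * circMom r (-2) (4 * β) (i - M + k) := by
    intro k
    rw [sum_cMom_mul hr β hM hP]
    congr 1
    push_cast
    ring
  have h2 : ∀ i : ℕ, cMom r β u z₁ (i - M) * funB r s β u (z₂ - β) (i - M)
      = -∑ k ∈ Finset.range M, cMom r β u z₁ (i - M) * circMom r (-2) (4 * β) (i - M + k)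
        * lineMom s 1 (2 * (z₂ - β)) (u - k - 1) := by
    intro i
    rw [funB_level hr hrs β u (M := M) z₂ (by omega), mul_add]
    have : cMom r β u z₁ (i - M) * circMom r (-1) (2 * (z₂ + β)) (u + (i - M)) = 0 := by
      rcases lt_or_ge (u + ((i : ℤ) - M)) 0 with h | h
      · rw [cMom_eq_zero hr β z₁ h, zero_mul]
      · rw [circMom_of_nonneg hr _ _ h, mul_zero]
    rw [this, add_zero, mul_neg, Finset.mul_sum]
    congr 1
    exact Finset.sum_congr rfl fun k _ => by ring
  simp only [h1, h2, Finset.sum_neg_distrib, Finset.sum_mul]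
  rw [Finset.sum_comm, show -2 * (β - z₂) = 2 * (z₂ - β) by ring]
  ring

/-- The same convolution identifies the double integral in `𝒜` with `𝒦 cMom`. This is why
subtracting `cMom` from `(1 - 𝒦)⁻¹ 𝒜` cancels all `𝒦` terms once `1 - 𝒦` is applied. -/
lemma funA_level {r s : ℝ} (hr : 0 < r) (hrs : r < s) (β : ℝ) {u : ℤ} {M P : ℕ}
    (hM : u ≤ M) (hP : (P : ℤ) = max (-u) 0) (z : ℝ) (l : ℤ) :
    funA r s β u (z - β) l = lineMom s 1 (-2 * (z + β)) (-u - l - 1)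
      - ∑ i ∈ Finset.range (M + P), kernelK r s β l (i - M) * cMom r β u z (i - M) := by
  rw [funA_eq_sum hr hrs β (z - β) l (m := M) (by omega)]
  have h1 : ∀ k : ℕ, circMom r (-1) (-2 * ((z - β : ℝ) : ℂ)) (-u + k)
      = ∑ i ∈ Finset.range (M + P), cMom r β u z (i - M) * circMom r (-2) (4 * β) (i - M + k) := by
    intro k
    rw [sum_cMom_mul hr β hM hP]
    congr 1
    push_cast
    ring
  have h2 : ∀ i : ℕ, kernelK r s β l (i - M) * cMom r β u z (i - M)
      = ∑ k ∈ Finset.range M, cMom r β u z (i - M) * circMom r (-2) (4 * β) (i - M + k)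
        * lineMom s 2 (-4 * β) (-l - k - 2) := by
    intro i
    rw [kernelK_eq_sum hr hrs β l (m := M) (by omega), Finset.sum_mul]
    exact Finset.sum_congr rfl fun k _ => by ring
  simp only [h1, h2, Finset.sum_mul]
  rw [Finset.sum_comm, show -2 * (z - β + 2 * β) = -2 * (z + β) by ring]
  ring

/-- Neither circle integrand has a pole at `0` in this range; this truncates the infinite sum in the
kernel. -/
lemma funB_of_le {r s : ℝ} (hr : 0 < r) (hrs : r < s) (β : ℝ) {u : ℤ} {P : ℕ}
    (hP : (P : ℤ) = max (-u) 0) (z : ℝ) {l : ℤ} (hl : (P : ℤ) ≤ l) :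
    funB r s β u (z - β) l = 0 := by
  rw [funB_level hr hrs β u (M := 0) z (by push_cast; omega), circMom_of_nonneg hr _ _ (by omega)]
  simp

/-- `(1 - 𝒦^β)⁻¹ 𝒜` at the particle position `z`. -/
def resolventA (r s β : ℝ) (ρ : ℕ) (u : ℤ) (z : ℝ) : ℕ → ℂ :=
  resolventApply r s β ρ fun j => funA r s β u (z - β) ((j : ℤ) - ρ)

/-- Solvability rules out the default value `0` in `resolventApply`, and the vanishing columns make
the series finite. -/
lemma resolventA_eq {r s : ℝ} (hr : 0 < r) (hrs : r < s) (β : ℝ) {ρ : ℕ}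
    (hD : fredholmDet r s β ρ ≠ 0) (u : ℤ) (z : ℝ) (i : ℕ) :
    resolventA r s β ρ u z i = funA r s β u (z - β) (i - ρ)
      + ∑ j ∈ Finset.range ρ, kernelK r s β (i - ρ) (j - ρ) * resolventA r s β ρ u z j := by
  have hex := (existsUnique_isResolventSolution hr hrs β hD
    (geomDecay_funA hr hrs β ρ u (z - β)).summable_sq).exists
  have h : IsResolventSolution r s β ρ (fun j => funA r s β u (z - β) ((j : ℤ) - ρ))
      (resolventA r s β ρ u z) := by
    unfold resolventA resolventApply
    rw [dif_pos hex]
    exact hex.choose_spec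
  rw [← (hasSum_kernelK_iff hr hrs β ρ _ _ _).1 (h.2 i)]
  ring

/-- The left factor of the one-level kernel. -/
def leftFactor (r s β : ℝ) (ρ a : ℕ) (u : ℤ) (z : ℝ) (i : ℕ) : ℂ :=
  (if i < a then 0 else resolventA r s β ρ u z (i - a)) - cMom r β u z (i - (a + ρ : ℕ))

/-- The `a` extra indices below `-ρ` are needed when `u > ρ`, where the minor kernel reaches further
down than the resolvent sum; the resolvent is extended there by `0`. -/
lemma tacnodeKernel_eq_sum {r s : ℝ} (hr : 0 < r) (hrs : r < s) (β : ℝ) {ρ a P : ℕ} {u : ℤ}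
    (hM : u ≤ (a + ρ : ℕ)) (hP : (P : ℤ) = max (-u) 0) (z₁ z₂ : ℝ) :
    tacnodeKernel r s β ρ u z₁ u z₂ = 2 * ∑ i ∈ Finset.range (a + ρ + P),
      leftFactor r s β ρ a u z₁ i * funB r s β u (z₂ - β) (i - (a + ρ : ℕ)) := by
  unfold tacnodeKernel
  rw [minorKernel_level hr hrs β hM hP, tsum_eq_sum (s := Finset.range (ρ + P)) fun i hi => by
    rw [Finset.mem_range, not_lt] at hi
    rw [funB_of_le hr hrs β hP z₂ (by omega), mul_zero]]
  simp only [leftFactor, sub_mul, Finset.sum_sub_distrib]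
  have h : ∑ i ∈ Finset.range (a + ρ + P), (if i < a then 0 else resolventA r s β ρ u z₁ (i - a))
      * funB r s β u (z₂ - β) (i - (a + ρ : ℕ))
      = ∑ i ∈ Finset.range (ρ + P), resolventA r s β ρ u z₁ i * funB r s β u (z₂ - β) (i - ρ) := by
    rw [add_assoc, Finset.sum_range_add, Finset.sum_eq_zero, zero_add]
    · refine Finset.sum_congr rfl fun i _ => ?_
      rw [if_neg (by omega), Nat.add_sub_cancel_left]
      congr 2
      push_cast
      ring
    · intro i hi
      rw [if_pos (Finset.mem_range.1 hi), zero_mul]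
  rw [h]
  unfold resolventA
  ring

lemma leftFactor_sub {r s : ℝ} (hr : 0 < r) (hrs : r < s) (β : ℝ) {ρ a P : ℕ} {u : ℤ}
    (hD : fredholmDet r s β ρ ≠ 0) (hM : u ≤ (a + ρ : ℕ)) (hP : (P : ℤ) = max (-u) 0) (z : ℝ)
    (i : ℕ) :
    leftFactor r s β ρ a u z i - ∑ j ∈ Finset.range (a + ρ + P),
        (if i < a then 0 else kernelK r s β (i - (a + ρ : ℕ)) (j - (a + ρ : ℕ)))
          * leftFactor r s β ρ a u z j
      = leftRow r s β ρ u z (i - (a + ρ : ℕ)) := by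
  unfold leftRow
  rcases lt_or_ge i a with hi | hi
  · rw [if_neg (by push_cast; omega)]
    simp [leftFactor, hi]
  · rw [if_pos (by push_cast; omega)]
    obtain ⟨k, rfl⟩ := Nat.exists_eq_add_of_le hi
    have hk : ((a + k : ℕ) : ℤ) - (a + ρ : ℕ) = k - ρ := by push_cast; ring
    have h1 : ∑ j ∈ Finset.range (a + ρ + P),
        kernelK r s β (k - ρ) (j - (a + ρ : ℕ)) * (if j < a then 0 else resolventA r s β ρ u z (j - a))
        = ∑ j ∈ Finset.range ρ, kernelK r s β (k - ρ) (j - ρ) * resolventA r s β ρ u z j := by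
      rw [Finset.sum_range_add, Finset.sum_range_add, Finset.sum_eq_zero, zero_add,
        Finset.sum_eq_zero (s := Finset.range P), add_zero]
      · refine Finset.sum_congr rfl fun j _ => ?_
        rw [if_neg (by omega), Nat.add_sub_cancel_left]
        congr 2
        push_cast
        ring
      · intro j _
        rw [kernelK_of_nonneg hr hrs β _ (by push_cast; omega), zero_mul]
      · intro j hj
        rw [if_pos (Finset.mem_range.1 hj), mul_zero]
    simp only [if_neg (not_lt.2 hi), hk]
    simp only [leftFactor, mul_sub, Finset.sum_sub_distrib, h1, hk, if_neg (not_lt.2 hi),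
      Nat.add_sub_cancel_left]
    rw [resolventA_eq hr hrs β hD, funA_level hr hrs β hM hP]
    ring

/-- The circle moment in `ℬ` is a convolution with the weight `(-2, 4β)`, and the double integral
carries the same weight after the substitution `k = M - 1 - j`. One Toeplitz factor, triangular with
unit diagonal, thus comes out of both terms. -/
lemma funB_eq_sum_rightRow {r s : ℝ} (hr : 0 < r) (hrs : r < s) (β : ℝ) {M P : ℕ} {u : ℤ}
    (hP : (P : ℤ) = max (-u) 0) (z : ℝ) {i : ℕ} (hi : i < M + P) :
    funB r s β u (z - β) (i - M) = ∑ j ∈ Finset.range (M + P),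
      circMom r (-2) (4 * β) (i - j - 1) * rightRow r s β u z (j - M) := by
  have h1 : circMom r (-1) (2 * (z + β)) (u + (i - M)) = ∑ j ∈ Finset.range (M + P),
      circMom r (-2) (4 * β) (i - j - 1) * circMom r 1 (2 * (z - β)) (u + (j - M)) := by
    obtain ⟨n, hn⟩ := Nat.exists_eq_add_of_lt hi
    have h := circMom_add hr (-2) (4 * β) 1 (2 * (z - β)) (N := u + (i - M)) (n := n + 1)
      (by push_cast; omega)
    rw [show (-2 + 1 : ℂ) = -1 by norm_num, show (4 * β + 2 * (z - β) : ℂ) = 2 * (z + β) by ring]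
      at h
    rw [h, hn, add_assoc i, Finset.sum_range_add _ i, Finset.sum_eq_zero (s := Finset.range i), zero_add]
    · refine Finset.sum_congr rfl fun j _ => ?_
      congr 2 <;> push_cast <;> ring
    · intro j hj
      rw [Finset.mem_range] at hj
      rw [circMom_of_nonneg hr _ _ (by omega), zero_mul]
  have h2 : ∑ k ∈ Finset.range M,
      circMom r (-2) (4 * β) (i - M + k) * lineMom s 1 (2 * (z - β)) (u - k - 1)
      = ∑ j ∈ Finset.range (M + P), circMom r (-2) (4 * β) (i - j - 1)
        * if (j : ℤ) - M < 0 then lineMom s 1 (2 * (z - β)) (u + (j - M)) else 0 := by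
    rw [Finset.sum_range_add, Finset.sum_eq_zero (s := Finset.range P), add_zero,
      ← Finset.sum_range_reflect]
    · refine Finset.sum_congr rfl fun j hj => ?_
      rw [Finset.mem_range] at hj
      have : ((M - 1 - j : ℕ) : ℤ) = M - 1 - j := by omega
      rw [if_pos (by omega), this]
      congr 2 <;> ring
    · intro j _
      rw [if_neg (by push_cast; omega), mul_zero]
  rw [funB_level hr hrs β u (M := M) z (by omega), h1, h2]
  simp only [rightRow, mul_sub, Finset.sum_sub_distrib]
  ring

/-- The last `P` columns of `𝒦` vanish and its first `a` rows are set to zero, so the matrix is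
block triangular with identity blocks around `1 - finiteK`. -/
lemma det_one_sub_extended {r s : ℝ} (hr : 0 < r) (hrs : r < s) (β : ℝ) (ρ a P : ℕ) :
    (1 - Matrix.of fun i j : Fin (a + ρ + P) => if (i : ℕ) < a then 0
      else kernelK r s β ((i : ℕ) - (a + ρ : ℕ)) ((j : ℕ) - (a + ρ : ℕ))).det
      = fredholmDet r s β ρ := by
  rw [fredholmDet_eq, ← Matrix.det_submatrix_equiv_self finSumFinEquiv,
    ← Matrix.fromBlocks_toBlocks (Matrix.submatrix _ _ _)]
  set X := (1 - Matrix.of fun i j : Fin (a + ρ + P) => if (i : ℕ) < a then 0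
      else kernelK r s β ((i : ℕ) - (a + ρ : ℕ)) ((j : ℕ) - (a + ρ : ℕ)) : Matrix _ _ ℂ) with hX
  set Y := X.submatrix finSumFinEquiv finSumFinEquiv with hY
  have h12 : Y.toBlocks₁₂ = 0 := by
    ext i j
    have : (Fin.castAdd P i : Fin (a + ρ + P)) ≠ Fin.natAdd (a + ρ) j := fun h => by
      have := congrArg Fin.val h
      simp at this
      omega
    simp only [hY, hX, Matrix.toBlocks₁₂, Matrix.of_apply, Matrix.submatrix_apply,
      finSumFinEquiv_apply_left, finSumFinEquiv_apply_right, Matrix.sub_apply,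
      Matrix.one_apply_ne this, Matrix.zero_apply]
    rw [kernelK_of_nonneg hr hrs β _ (by simp)]
    simp
  have h22 : Y.toBlocks₂₂ = 1 := by
    ext i j
    simp only [hY, hX, Matrix.toBlocks₂₂, Matrix.of_apply, Matrix.submatrix_apply,
      finSumFinEquiv_apply_right, Matrix.sub_apply, Matrix.one_apply]
    rw [kernelK_of_nonneg hr hrs β _ (by simp)]
    simp
  rw [h12, h22, Matrix.det_fromBlocks_zero₁₂, Matrix.det_one, mul_one,
    ← Matrix.det_submatrix_equiv_self finSumFinEquiv,
    ← Matrix.fromBlocks_toBlocks (Matrix.submatrix _ _ _)]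
  set Z := Y.toBlocks₁₁.submatrix finSumFinEquiv finSumFinEquiv with hZ
  have k12 : Z.toBlocks₁₂ = 0 := by
    ext i j
    have : (Fin.castAdd P (Fin.castAdd ρ i) : Fin (a + ρ + P)) ≠ Fin.castAdd P (Fin.natAdd a j) :=
      fun h => by
        have := congrArg Fin.val h
        simp at this
        omega
    simp only [hZ, hY, hX, Matrix.toBlocks₁₂, Matrix.toBlocks₁₁, Matrix.of_apply,
      Matrix.submatrix_apply, finSumFinEquiv_apply_left, finSumFinEquiv_apply_right,
      Matrix.sub_apply, Matrix.one_apply_ne this, Matrix.zero_apply]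
    rw [if_pos (by simp)]
    simp
  have k11 : Z.toBlocks₁₁ = 1 := by
    ext i j
    simp only [hZ, hY, hX, Matrix.toBlocks₁₁, Matrix.of_apply,
      Matrix.submatrix_apply, finSumFinEquiv_apply_left, Matrix.sub_apply, Matrix.one_apply]
    rw [if_pos (c := ((_ : Fin _) : ℕ) < a) (by simp)]
    simp
  rw [k12, k11, Matrix.det_fromBlocks_zero₁₂, Matrix.det_one, one_mul]
  congr 1
  ext i j
  simp only [hZ, hY, hX, Matrix.toBlocks₂₂, Matrix.toBlocks₁₁, Matrix.of_apply,
    Matrix.submatrix_apply, finSumFinEquiv_apply_left, finSumFinEquiv_apply_right,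
    Matrix.sub_apply, Matrix.one_apply, finiteK]
  rw [if_neg (c := ((_ : Fin _) : ℕ) < a) (by simp)]
  simp

/-- The one-level determinant of the tacnode kernel, factored. -/
lemma tacnodeDet_eq_mul_det {r s : ℝ} (hr : 0 < r) (hrs : r < s) (β : ℝ) {ρ a P : ℕ} {u : ℤ}
    (hD : fredholmDet r s β ρ ≠ 0) (hM : u ≤ (a + ρ : ℕ)) (hP : (P : ℤ) = max (-u) 0)
    (z : Fin (a + ρ + P) → ℝ) :
    tacnodeDet r s β ρ u z = 2 ^ (a + ρ + P) * (fredholmDet r s β ρ)⁻¹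
      * (Matrix.of fun i j : Fin (a + ρ + P) =>
          leftRow r s β ρ u (z j) ((i : ℕ) - (a + ρ : ℕ))).det
      * (Matrix.of fun i j : Fin (a + ρ + P) =>
          rightRow r s β u (z j) ((i : ℕ) - (a + ρ : ℕ))).det := by
  set G : Matrix (Fin (a + ρ + P)) (Fin (a + ρ + P)) ℂ :=
    Matrix.of fun i j => leftFactor r s β ρ a u (z j) i with hG
  set B : Matrix (Fin (a + ρ + P)) (Fin (a + ρ + P)) ℂ :=
    Matrix.of fun i j => funB r s β u (z j - β) ((i : ℕ) - (a + ρ : ℕ)) with hB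
  set T : Matrix (Fin (a + ρ + P)) (Fin (a + ρ + P)) ℂ :=
    Matrix.of fun i j => circMom r (-2) (4 * β) ((i : ℕ) - (j : ℕ) - 1) with hT
  have hker : (Matrix.of fun i j => tacnodeKernel r s β ρ u (z i) u (z j))
      = (2 : ℂ) • (G.transpose * B) := by
    ext i j
    simp only [Matrix.of_apply, Matrix.smul_apply, Matrix.mul_apply, Matrix.transpose_apply,
      smul_eq_mul, hG, hB]
    rw [tacnodeKernel_eq_sum hr hrs β hM hP, Finset.sum_range]
  have hleft : (1 - Matrix.of fun i j : Fin (a + ρ + P) => if (i : ℕ) < a then 0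
      else kernelK r s β ((i : ℕ) - (a + ρ : ℕ)) ((j : ℕ) - (a + ρ : ℕ))) * G
      = Matrix.of fun i j : Fin (a + ρ + P) =>
          leftRow r s β ρ u (z j) ((i : ℕ) - (a + ρ : ℕ)) := by
    ext i j
    rw [Matrix.sub_mul, Matrix.one_mul, Matrix.sub_apply, Matrix.mul_apply]
    simp only [Matrix.of_apply, hG]
    rw [← leftFactor_sub hr hrs β hD hM hP, Finset.sum_range]
  have hright : T * (Matrix.of fun i j : Fin (a + ρ + P) =>
          rightRow r s β u (z j) ((i : ℕ) - (a + ρ : ℕ))) = B := by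
    ext i j
    rw [Matrix.mul_apply]
    simp only [Matrix.of_apply, hB, hT]
    rw [funB_eq_sum_rightRow hr hrs β hP (z j) i.2, Finset.sum_range]
  have hTdet : T.det = 1 := by
    rw [Matrix.det_of_isUpperTriangular]
    · refine Finset.prod_eq_one fun i _ => ?_
      simp [hT, circMom_neg_one hr]
    · intro i j hij
      have hij' : (j : ℕ) < i := hij
      simp only [hT, Matrix.of_apply]
      exact circMom_of_nonneg hr _ _ (by omega)
  unfold tacnodeDet
  rw [hker, Matrix.det_smul, Matrix.det_mul, Matrix.det_transpose, ← hleft, ← hright,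
    Matrix.det_mul, Matrix.det_mul, hTdet, det_one_sub_extended hr hrs, Fintype.card_fin]
  field_simp

/-! ### Positivity of the Fredholm determinant -/

lemma integrableOn_pow_mul_gaussMom {a : ℝ} (ha : 0 < a) (c : ℝ) (n : ℕ) :
    IntegrableOn (fun ξ : ℝ => ξ ^ n * gaussMom a (c - ξ)) (Set.Ioi 0) := by
  obtain ⟨C, hC⟩ : ∃ C : ℝ, ∀ ξ : ℝ, gaussMom a (c - ξ) ≤ C * Real.exp (-1 * ξ) := by
    -- Completing the square: the exponent `-(c - ξ)² / (4a)` is at most `c + a - ξ`.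
    refine ⟨(2 * Real.sqrt (Real.pi * a))⁻¹ * Real.exp (c + a), fun ξ => ?_⟩
    rw [gaussMom_eq, mul_assoc, ← Real.exp_add]
    gcongr
    have h : c + a + -1 * ξ - -(1 / (4 * a)) * (c - ξ) ^ 2 = (c - ξ + 2 * a) ^ 2 / (4 * a) := by
      field_simp
      ring
    have : 0 ≤ (c - ξ + 2 * a) ^ 2 / (4 * a) := by positivity
    linarith
  have hc := (continuous_gaussMom a).comp (continuous_const.sub continuous_id : Continuous fun ξ => c - ξ)
  refine Integrable.mono' ((integrableOn_pow_mul_exp_neg one_pos n).const_mul C)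
    ((continuous_pow n).mul hc).aestronglyMeasurable ?_
  refine (ae_restrict_iff' measurableSet_Ioi).2 (Filter.Eventually.of_forall fun ξ hξ => ?_)
  have hξ' : (0 : ℝ) < ξ := hξ
  have h1 := gaussMom_pos ha (c - ξ)
  rw [Real.norm_of_nonneg (by positivity)]
  calc ξ ^ n * gaussMom a (c - ξ) ≤ ξ ^ n * (C * Real.exp (-1 * ξ)) := by gcongr; exact hC ξ
    _ = _ := by ring

/-- The Hankel matrix of the moments of a Gaussian on the half-line. -/
def gaussHankel (a c : ℝ) (n : ℕ) : Matrix (Fin n) (Fin n) ℝ :=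
  Matrix.of fun i j => ∫ ξ in Set.Ioi (0 : ℝ), ξ ^ ((i : ℕ) + j) * gaussMom a (c - ξ)

/-- The quadratic form at `x` is the half-line integral of `P²` against a Gaussian, `P` being the
polynomial with coefficients `x`; a nonzero `P` has only finitely many zeros. -/
lemma gaussHankel_posDef {a : ℝ} (ha : 0 < a) (c : ℝ) (n : ℕ) : (gaussHankel a c n).PosDef := by
  refine Matrix.PosDef.of_dotProduct_mulVec_pos ?_ fun x hx => ?_
  · ext i j
    simp [gaussHankel, add_comm]
  set P : Polynomial ℝ := ∑ i : Fin n, Polynomial.C (x i) * Polynomial.X ^ (i : ℕ) with hP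
  have hPe : ∀ ξ, P.eval ξ = ∑ i : Fin n, x i * ξ ^ (i : ℕ) := fun ξ => by
    simp [hP, Polynomial.eval_finsetSum]
  have hP0 : P ≠ 0 := by
    obtain ⟨i, hi⟩ := Function.ne_iff.1 hx
    intro h
    have := congrArg (fun p => Polynomial.coeff p i) h
    simp only [hP, Polynomial.finsetSum_coeff, Polynomial.coeff_C_mul_X_pow,
      Polynomial.coeff_zero] at this
    rw [Finset.sum_eq_single i (fun j _ hj => if_neg fun h' => hj (Fin.ext h'.symm)) (by simp)]
      at this
    simp at this
    exact hi this
  have hexp : ∀ ξ, P.eval ξ ^ 2 * gaussMom a (c - ξ)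
      = ∑ i : Fin n, ∑ j : Fin n, x i * x j * (ξ ^ ((i : ℕ) + j) * gaussMom a (c - ξ)) := fun ξ => by
    rw [hPe, pow_two, Finset.sum_mul_sum, Finset.sum_mul]
    refine Finset.sum_congr rfl fun i _ => ?_
    rw [Finset.sum_mul]
    exact Finset.sum_congr rfl fun j _ => by rw [pow_add]; ring
  have hi : ∀ i j : Fin n, IntegrableOn
      (fun ξ => x i * x j * (ξ ^ ((i : ℕ) + j) * gaussMom a (c - ξ))) (Set.Ioi 0) := fun i j =>
    (integrableOn_pow_mul_gaussMom ha c _).const_mul _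
  have hint : IntegrableOn (fun ξ => P.eval ξ ^ 2 * gaussMom a (c - ξ)) (Set.Ioi 0) := by
    simp only [hexp]
    exact integrable_finsetSum _ fun i _ => integrable_finsetSum _ fun j _ => hi i j
  have hval : star x ⬝ᵥ (gaussHankel a c n).mulVec x
      = ∫ ξ in Set.Ioi (0 : ℝ), P.eval ξ ^ 2 * gaussMom a (c - ξ) := by
    simp only [hexp]
    rw [integral_finsetSum _ fun i _ => integrable_finsetSum _ fun j _ => hi i j]
    simp only [dotProduct, Matrix.mulVec, star_trivial, Finset.mul_sum]
    refine Finset.sum_congr rfl fun i _ => ?_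
    rw [integral_finsetSum _ fun j _ => hi i j]
    refine Finset.sum_congr rfl fun j _ => ?_
    rw [integral_const_mul]
    simp only [gaussHankel, Matrix.of_apply]
    ring
  rw [hval, setIntegral_pos_iff_support_of_nonneg_ae _ hint]
  · have hsub : Set.Ioi (0 : ℝ) \ (P.roots.toFinset : Set ℝ)
        ⊆ Function.support (fun ξ => P.eval ξ ^ 2 * gaussMom a (c - ξ)) ∩ Set.Ioi 0 := by
      rintro ξ ⟨h1, h2⟩
      refine ⟨?_, h1⟩
      have : P.eval ξ ≠ 0 := fun h => h2 (by simp [hP0, h])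
      exact mul_ne_zero (pow_ne_zero 2 this) (gaussMom_pos ha _).ne'
    refine lt_of_lt_of_le ?_ (measure_mono hsub)
    rw [measure_sdiff_null (Finset.measure_zero _ _)]
    simp
  · exact Filter.Eventually.of_forall fun ξ =>
      mul_nonneg (sq_nonneg _) (gaussMom_pos ha _).le

lemma realMom_sub {a : ℝ} (ha : 0 < a) (c : ℝ) (q i : ℕ) :
    realMom a c ((q : ℤ) - i - 1) = (i.factorial : ℝ)⁻¹ *
      ∫ ξ in Set.Ioi (0 : ℝ), ξ ^ i * polyMom a (c - ξ) q := by
  have h := lineMom_laplace one_pos ha c q i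
  simp only [lineMom_eq_realMom one_pos ha] at h
  rw [show (q : ℤ) - i - 1 = q - (i + 1) by ring]
  apply Complex.ofReal_injective
  rw [h, Complex.ofReal_mul, ← integral_complex_ofReal]
  push_cast
  rfl

/-- By the Laplace formula the matrix is the diagonal of `1 / i!`, times the Hankel matrix, times
the coefficients of polynomials of degree `q` with positive leading coefficient `(2a)^{-q}`. -/
lemma det_realMom_pos {a : ℝ} (ha : 0 < a) (c : ℝ) (n : ℕ) :
    0 < (Matrix.of fun i q : Fin n => realMom a c ((q : ℕ) - (i : ℕ) - 1)).det := by
  choose f hf hfe using fun q => exists_isPolyLead_polyMom (a := a) (-1) c q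
  choose P hPd hPc hPe using hf
  have key : (Matrix.of fun i q : Fin n => realMom a c ((q : ℕ) - (i : ℕ) - 1))
      = (Matrix.of fun i q : Fin n => ((i : ℕ).factorial : ℝ)⁻¹ *
        (gaussHankel a c n * Matrix.of fun l q : Fin n => (P q).coeff l) i q) := by
    ext i q
    simp only [Matrix.of_apply, Matrix.mul_apply, gaussHankel]
    rw [realMom_sub ha]
    congr 1
    simp only [← integral_mul_const]
    rw [← integral_finsetSum _ fun l _ => (integrableOn_pow_mul_gaussMom ha c _).mul_const _]
    refine integral_congr_ae (Filter.Eventually.of_forall fun ξ => ?_)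
    simp only
    have h1 := hfe q ξ
    rw [show -1 * ξ + c = c - ξ by ring, hPe,
      Polynomial.eval_eq_sum_range' ((hPd q).trans_lt q.2), Finset.sum_range] at h1
    rw [h1, Finset.mul_sum, Finset.mul_sum]
    exact Finset.sum_congr rfl fun l _ => by rw [pow_add]; ring
  rw [key, Matrix.det_mul_column, Matrix.det_mul, Matrix.det_of_isUpperTriangular
    (M := Matrix.of fun l q : Fin n => (P q).coeff l)]
  · refine mul_pos (Finset.prod_pos fun i _ => by positivity) (mul_pos
      (gaussHankel_posDef ha c n).det_pos (Finset.prod_pos fun i _ => ?_))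
    rw [Matrix.of_apply, hPc]
    rw [neg_neg]
    positivity
  · intro i j hij
    have : (j : ℕ) < i := hij
    exact Polynomial.coeff_eq_zero_of_natDegree_lt ((hPd j).trans_lt this)

lemma circMom_zero_zero {r : ℝ} (hr : 0 < r) (m : ℤ) :
    circMom r 0 0 m = if m = -1 then 1 else 0 := by
  split_ifs with h
  · rw [h, circMom_neg_one hr]
  · have := circleIntegral.integral_sub_zpow_of_ne h 0 0 r
    simp only [sub_zero] at this
    simp [circMom, circleInt, qexp, this]

/-- The identity is a product of Toeplitz matrices with opposite weights, so it shares with `𝒦` the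
factor of weight `(-2, 4β)`. The complementary factors differ by circle minus line moments, which
reflection turns into line moments at `4β` with alternating signs. -/
lemma one_sub_finiteK_apply {r s : ℝ} (hr : 0 < r) (hrs : r < s) (β : ℝ) (ρ : ℕ) (i j : Fin ρ) :
    (1 - finiteK r s β ρ) i j = ∑ q : Fin ρ,
      ((-1) ^ (i : ℕ) * ((-1) ^ (q : ℕ) * (realMom 2 (4 * β) ((q : ℕ) - (i : ℕ) - 1) : ℂ)))
        * circMom r (-2) (4 * β) ((j : ℕ) - (q : ℕ) - 1) := by
  have hs := hr.trans hrs
  have hi := i.2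
  have hK : kernelK r s β ((i : ℕ) - ρ) ((j : ℕ) - ρ) = ∑ q ∈ Finset.range ρ,
      circMom r (-2) (4 * β) ((j : ℕ) - q - 1) * lineMom s 2 (-(4 * β)) (q - (i : ℕ) - 1) := by
    rw [kernelK_eq_sum hr hrs β _ (m := ρ) (by omega), ← Finset.sum_range_reflect]
    refine Finset.sum_congr rfl fun q hq => ?_
    rw [Finset.mem_range] at hq
    have : ((ρ - 1 - q : ℕ) : ℤ) = ρ - 1 - q := by omega
    rw [this, neg_mul]
    congr 2 <;> ring
  have hδ : ∑ q ∈ Finset.range ρ, circMom r (-2) (4 * β) ((j : ℕ) - q - 1)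
      * circMom r 2 (-(4 * β)) (q - (i : ℕ) - 1) = (1 : Matrix (Fin ρ) (Fin ρ) ℂ) i j := by
    have h := circMom_add hr 2 (-(4 * β)) (-2) (4 * β) (N := (j : ℕ) - (i : ℕ) - 1)
      (n := i + 1) (by push_cast; omega)
    rw [show (2 + -2 : ℂ) = 0 by norm_num, neg_add_cancel, circMom_zero_zero hr] at h
    have h1 : (if (((j : ℕ) : ℤ) - (i : ℕ) - 1 = -1) then (1 : ℂ) else 0)
        = (1 : Matrix (Fin ρ) (Fin ρ) ℂ) i j := by
      rw [Matrix.one_apply]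
      refine if_congr ?_ rfl rfl
      rw [Fin.ext_iff]
      omega
    obtain ⟨n, hn⟩ := Nat.exists_eq_add_of_lt hi
    rw [← h1, h, show Finset.range ρ = Finset.range ((i : ℕ) + 1 + n) from congrArg _ (by omega),
      Finset.sum_range_add _ ((i : ℕ) + 1),
      Finset.sum_eq_zero (s := Finset.range n), add_zero, ← Finset.sum_range_reflect]
    · refine Finset.sum_congr rfl fun q hq => ?_
      rw [Finset.mem_range] at hq
      have : (((i : ℕ) + 1 - 1 - q : ℕ) : ℤ) = (i : ℕ) - q := by omega
      rw [this, mul_comm]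
      congr 2 <;> ring
    · intro q _
      rw [circMom_of_nonneg hr 2 _ (by push_cast; omega), mul_zero]
  have hT : ∀ q : ℕ, circMom r 2 (-(4 * β)) (q - (i : ℕ) - 1)
      - lineMom s 2 (-(4 * β)) (q - (i : ℕ) - 1)
      = (-1) ^ (i : ℕ) * ((-1) ^ q * (realMom 2 (4 * β) (q - (i : ℕ) - 1) : ℂ)) := fun q => by
    have h := lineMom_sub_lineMom_neg hr hs two_pos (-(4 * β)) (q - (i : ℕ) - 1)
    rw [neg_neg] at h
    have h2 : (-1 : ℂ) ^ ((q : ℤ) - (i : ℕ) - 1) = -((-1) ^ (i : ℕ) * (-1) ^ q) := by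
      rw [zpow_sub₀ (by norm_num), zpow_sub₀ (by norm_num), zpow_natCast, zpow_natCast, zpow_one]
      have : ((-1 : ℂ) ^ (i : ℕ)) * (-1) ^ (i : ℕ) = 1 := by rw [← mul_pow]; norm_num
      field_simp
      linear_combination this
    rw [h2] at h
    rw [← lineMom_eq_realMom hs two_pos]
    push_cast at h
    linear_combination -h
  rw [Matrix.sub_apply, ← hδ, finiteK, Matrix.of_apply, hK, ← Finset.sum_sub_distrib,
    Finset.sum_range]
  refine Finset.sum_congr rfl fun q _ => ?_
  rw [← hT]
  ring

lemma exists_fredholmDet_eq {r s : ℝ} (hr : 0 < r) (hrs : r < s) (β : ℝ) (ρ : ℕ) :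
    ∃ D : ℝ, 0 < D ∧ fredholmDet r s β ρ = D := by
  refine ⟨_, det_realMom_pos two_pos (4 * β) ρ, ?_⟩
  set W : Matrix (Fin ρ) (Fin ρ) ℝ :=
    Matrix.of fun i q => realMom 2 (4 * β) ((q : ℕ) - (i : ℕ) - 1) with hW
  have h : (1 - finiteK r s β ρ) = (Matrix.of fun i q : Fin ρ => (-1) ^ (i : ℕ) *
      (Matrix.of fun i q : Fin ρ => (-1) ^ (q : ℕ) * (W.map Complex.ofRealHom) i q) i q)
      * Matrix.of fun q j : Fin ρ => circMom r (-2) (4 * β) ((j : ℕ) - (q : ℕ) - 1) := by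
    ext i j
    rw [one_sub_finiteK_apply hr hrs, Matrix.mul_apply]
    simp [hW]
  rw [fredholmDet_eq, h, Matrix.det_mul, Matrix.det_mul_column, Matrix.det_mul_row,
    Matrix.det_of_isLowerTriangular (M := Matrix.of fun q j : Fin ρ =>
      circMom r (-2) (4 * β) ((j : ℕ) - (q : ℕ) - 1))]
  · have h1 : ∏ i : Fin ρ, (Matrix.of fun q j : Fin ρ =>
        circMom r (-2) (4 * β) ((j : ℕ) - (q : ℕ) - 1)) i i = 1 :=
      Finset.prod_eq_one fun i _ => by simp [circMom_neg_one hr]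
    -- The signs occur once as row factors and once as column factors, so they cancel.
    rw [h1, mul_one, ← mul_assoc, ← Finset.prod_mul_distrib]
    simp only [← mul_pow]
    norm_num
    exact (RingHom.map_det Complex.ofRealHom W).symm
  · intro i j hij
    have : (i : ℕ) < j := hij
    exact circMom_of_nonneg hr _ _ (by omega)

/-! ### Row operations -/

/-- Reversal of the first `d` indices. -/
def revFirst {N d : ℕ} (hd : d ≤ N) : Equiv.Perm (Fin N) :=
  Function.Involutive.toPerm
    (fun i => ⟨if (i : ℕ) < d then d - 1 - i else i, by have := i.2; split_ifs <;> omega⟩)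
    fun i => by
      apply Fin.ext
      simp only
      split_ifs <;> omega

lemma revFirst_val {N d : ℕ} (hd : d ≤ N) (i : Fin N) :
    (revFirst hd i : ℕ) = if (i : ℕ) < d then d - 1 - i else i := rfl

lemma sign_revFirst {N d : ℕ} (hd : d ≤ N) :
    Equiv.Perm.sign (revFirst hd) = (-1) ^ (d * (d - 1) / 2) := by
  -- Inversions are counted by their larger index: all `j` smaller indices if `j < d`, none
  -- otherwise, in total `0 + 1 + ⋯ + (d - 1)`.
  have h : ∀ j : Fin N, ∏ i ∈ Finset.Iio j,
      (if (revFirst hd) i < (revFirst hd) j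
        then (1 : ℤˣ) else -1) = if (j : ℕ) < d then (-1) ^ (j : ℕ) else 1 := by
    intro j
    split_ifs with hj
    · rw [Finset.prod_congr rfl (g := fun _ => (-1 : ℤˣ)) fun i hi => if_neg ?_, Finset.prod_const,
        Fin.card_Iio]
      have hij : i < j := Finset.mem_Iio.1 hi
      rw [Fin.lt_def] at hij
      simp only [Fin.lt_def, revFirst_val]
      split_ifs <;> omega
    · refine Finset.prod_eq_one fun i hi => if_pos ?_
      have hij : i < j := Finset.mem_Iio.1 hi
      rw [Fin.lt_def] at hij
      simp only [Fin.lt_def, revFirst_val]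
      split_ifs <;> omega
  rw [Equiv.Perm.sign_eq_prod_prod_Iio, Finset.prod_congr rfl fun j _ => h j,
    Fin.prod_univ_eq_prod_range (fun j => if j < d then (-1 : ℤˣ) ^ j else 1)]
  obtain ⟨b, rfl⟩ := Nat.exists_eq_add_of_le hd
  rw [Finset.prod_range_add, Finset.prod_congr rfl fun j hj => if_pos (Finset.mem_range.1 hj),
    Finset.prod_eq_one (s := Finset.range b) fun j _ => if_neg (by omega), mul_one,
    Finset.prod_pow_eq_pow_sum, Finset.sum_range_id]

lemma det_reverse_first {R : Type*} [CommRing R] {N d : ℕ} (hd : d ≤ N) (f : ℕ → Fin N → R)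
    (g : ℕ → Fin N → R) :
    (Matrix.of fun k j : Fin N => if (k : ℕ) < d then f (d - 1 - k) j else g k j).det
      = (-1) ^ (d * (d - 1) / 2)
        * (Matrix.of fun k j : Fin N => if (k : ℕ) < d then f k j else g k j).det := by
  have h := Matrix.det_permute (revFirst hd)
    (Matrix.of fun k j : Fin N => if (k : ℕ) < d then f k j else g k j)
  rw [sign_revFirst hd] at h
  push_cast at h
  rw [← h]
  congr 1
  ext k j
  have hv := revFirst_val hd k
  simp only [Matrix.of_apply, Matrix.submatrix_apply, id_eq]
  by_cases hk : (k : ℕ) < d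
  · rw [if_pos hk] at hv
    rw [if_pos hk, if_pos (by omega), hv]
  · rw [if_neg hk] at hv
    rw [if_neg hk, if_neg (by omega), hv]

/-- Polynomial rows of increasing degree reduce to monomials. -/
lemma det_poly_rows {N : ℕ} (d : ℕ) (t : ℕ → ℝ) {f : ℕ → ℝ → ℝ}
    (hf : ∀ k < d, IsPolyLead k (t k) (f k)) (w : ℝ → ℝ) (z : Fin N → ℝ) (g : ℕ → Fin N → ℝ) :
    (Matrix.of fun k j : Fin N =>
        if (k : ℕ) < d then f k (z j) * w (z j) else t k * g k j).det
      = (∏ k ∈ Finset.range N, t k) * (Matrix.of fun k j : Fin N =>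
        if (k : ℕ) < d then z j ^ (k : ℕ) * w (z j) else g k j).det := by
  have hP : ∀ k, ∃ P : Polynomial ℝ, k < d →
      P.natDegree ≤ k ∧ P.coeff k = t k ∧ ∀ z, f k z = P.eval z := fun k => by
    by_cases hk : k < d
    · obtain ⟨P, h⟩ := hf k hk
      exact ⟨P, fun _ => h⟩
    · exact ⟨0, fun h => absurd h hk⟩
  choose P hP using hP
  -- Lower triangular with diagonal `t`. Rows from `d` on are only rescaled, which lets the same
  -- step absorb the signs of the `Phi` rows.
  set T : Matrix (Fin N) (Fin N) ℝ := Matrix.of fun k l =>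
    if (k : ℕ) < d then (P k).coeff l else if k = l then t k else 0 with hT
  have hmul : (Matrix.of fun k j : Fin N =>
        if (k : ℕ) < d then f k (z j) * w (z j) else t k * g k j)
      = T * Matrix.of fun k j : Fin N =>
        if (k : ℕ) < d then z j ^ (k : ℕ) * w (z j) else g k j := by
    ext k j
    rw [Matrix.mul_apply]
    simp only [hT, Matrix.of_apply]
    by_cases hk : (k : ℕ) < d
    · obtain ⟨h1, -, h3⟩ := hP k hk
      simp only [if_pos hk]
      rw [h3, Polynomial.eval_eq_sum_range' (h1.trans_lt k.2), Finset.sum_range, Finset.sum_mul]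
      refine Finset.sum_congr rfl fun l _ => ?_
      by_cases hl : (l : ℕ) < d
      · rw [if_pos hl, mul_assoc]
      · rw [Polynomial.coeff_eq_zero_of_natDegree_lt (by omega)]
        simp
    · simp only [if_neg hk]
      rw [Finset.sum_eq_single k (fun l _ hl => by rw [if_neg hl.symm, zero_mul]) (by simp),
        if_pos rfl, if_neg hk]
  rw [hmul, Matrix.det_mul, Matrix.det_of_isLowerTriangular]
  · congr 1
    rw [Finset.prod_range]
    refine Finset.prod_congr rfl fun k _ => ?_
    simp only [hT, Matrix.of_apply]
    split_ifs with hk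
    · exact (hP k hk).2.1
    · rfl
  · intro k l hkl
    have hkl' : (k : ℕ) < l := hkl
    simp only [hT, Matrix.of_apply]
    split_ifs with hk h
    · exact Polynomial.coeff_eq_zero_of_natDegree_lt ((hP k hk).1.trans_lt hkl')
    · exact absurd (congrArg Fin.val h) hkl'.ne
    · rfl

lemma exists_isPolyLead_Phi_negSucc (p q : ℝ) (n : ℕ) :
    ∃ f, IsPolyLead n ((-p) ^ n / 2) f ∧
      ∀ z, Phi (-(n : ℤ) - 1) (p * z + q) = f z * gauss (p * z + q) := by
  obtain ⟨f, hf, hf'⟩ := exists_isPolyLead_polyMom (a := 1) (2 * p) (2 * q) n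
  refine ⟨_, by
    have := hf.const_mul (1 / 2)
    rwa [show (1 / 2 : ℝ) * (-(2 * p) / (2 * 1)) ^ n = (-p) ^ n / 2 by
      rw [show -(2 * p) / (2 * 1) = -p by ring]; ring] at this, fun z => ?_⟩
  rw [show -(n : ℤ) - 1 = Int.negSucc n by rw [Int.negSucc_eq]; ring, Phi_negSucc,
    show 2 * (p * z + q) = 2 * p * z + 2 * q by ring, hf',
    show 2 * p * z + 2 * q = 2 * (p * z + q) by ring, gaussMom_one_two_mul]
  ring

lemma gauss_neg (x : ℝ) : gauss (-x) = gauss x := by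
  unfold gauss; rw [neg_sq]

/-- Rows `Φ_{-d}, …, Φ_{-1}, Φ_0, …` reduce to Gaussian monomials in decreasing degree, up to
the leading coefficients. -/
lemma det_Phi_rows {N d : ℕ} (hd : d ≤ N) (p q : ℝ) (z : Fin N → ℝ) :
    (Matrix.of fun k j : Fin N => Phi (((k : ℕ) : ℤ) - d) (p * z j + q)).det
      = (-1) ^ (d * (d - 1) / 2) * (∏ k ∈ Finset.range d, ((-p) ^ k / 2))
        * (Matrix.of fun k j : Fin N => if (k : ℕ) < d then z j ^ (k : ℕ) * gauss (p * z j + q)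
          else Phi (((k : ℕ) : ℤ) - d) (p * z j + q)).det := by
  choose f hf hfe using exists_isPolyLead_Phi_negSucc p q
  have h := det_poly_rows d (fun k => if k < d then (-p) ^ k / 2 else 1) (f := f)
    (fun k hk => by rw [if_pos hk]; exact hf k) (fun z => gauss (p * z + q)) z
    (fun k j => Phi ((k : ℤ) - d) (p * z j + q))
  have h1 : ∏ k ∈ Finset.range N, (if k < d then (-p) ^ k / 2 else 1)
      = ∏ k ∈ Finset.range d, ((-p) ^ k / 2) := by
    obtain ⟨b, rfl⟩ := Nat.exists_eq_add_of_le hd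
    rw [Finset.prod_range_add, Finset.prod_eq_one (s := Finset.range b) fun j _ =>
      if_neg (by omega), mul_one]
    exact Finset.prod_congr rfl fun j hj => if_pos (Finset.mem_range.1 hj)
  rw [h1] at h
  rw [mul_assoc, ← h]
  have h2 := det_reverse_first (R := ℝ) hd (fun k j => f k (z j) * gauss (p * z j + q))
    (fun k j => Phi ((k : ℤ) - d) (p * z j + q))
  have h3 : (Matrix.of fun k j : Fin N => if (k : ℕ) < d
      then f (d - 1 - k) (z j) * gauss (p * z j + q) else Phi (((k : ℕ) : ℤ) - d) (p * z j + q))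
      = Matrix.of fun k j : Fin N => Phi (((k : ℕ) : ℤ) - d) (p * z j + q) := by
    ext k j
    simp only [Matrix.of_apply]
    split_ifs with hk
    · rw [← hfe]
      congr 1
      omega
    · rfl
  rw [← h3, h2]
  congr 2
  ext k j
  simp only [Matrix.of_apply]
  split_ifs <;> simp

/-! ### The one-level determinants in terms of `Phi` -/

lemma neg_one_zpow_eq_pow {p : ℤ} {e : ℕ} (h : Even ((e : ℤ) - p)) : (-1 : ℂ) ^ p = (-1) ^ e := by
  obtain ⟨m, hm⟩ := h
  rw [← zpow_natCast, show (e : ℤ) = p + 2 * m by omega, zpow_add₀ (by norm_num), zpow_mul]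
  norm_num

lemma neg_one_pow_congr {a b : ℕ} (h : Even (a + b)) : (-1 : ℝ) ^ a = (-1) ^ b := by
  rcases Nat.even_or_odd a with ha | ha
  · rw [ha.neg_one_pow, (Nat.even_add.1 h |>.1 ha).neg_one_pow]
  · have hb : Odd b := by
      rw [← Nat.not_even_iff_odd] at ha ⊢
      exact fun hb => ha (Nat.even_add.1 h |>.2 hb)
    rw [ha.neg_one_pow, hb.neg_one_pow]

lemma det_ofReal {N : ℕ} (X : Fin N → Fin N → ℝ) :
    (Matrix.of fun i j => (X i j : ℂ)).det = ((Matrix.of X).det : ℂ) :=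
  (RingHom.map_det Complex.ofRealHom (Matrix.of X)).symm

/-- Line minus circle is the reflected line. The natural number `e` only records a parity, because
`u + l + 1` may be negative. -/
lemma leftRow_of_ge {r s : ℝ} (hr : 0 < r) (hs : 0 < s) (β : ℝ) {ρ : ℕ} (u : ℤ) (z : ℝ) {l : ℤ}
    (hl : -(ρ : ℤ) ≤ l) {e : ℕ} (he : Even ((e : ℤ) - (u + l + 1))) :
    leftRow r s β ρ u z l = ((-1 : ℝ) ^ e * Phi (u + l) (z + β) : ℝ) := by
  have h := lineMom_sub_lineMom_neg hr hs one_pos (-2 * (z + β)) (-u - l - 1)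
  have he' : Even ((e : ℤ) - (-u - l - 1)) := by
    obtain ⟨m, hm⟩ := he
    exact ⟨m + (u + l + 1), by omega⟩
  rw [leftRow, if_pos hl, cMom]
  rw [neg_one_zpow_eq_pow he', show -(-2 * (z + β)) = 2 * (z + β) by ring, lineMom_one hs,
    show -(-u - l - 1) - 1 = u + l by ring] at h
  push_cast at h ⊢
  linear_combination h

lemma rightRow_of_neg {r s : ℝ} (hr : 0 < r) (hs : 0 < s) (β : ℝ) (u : ℤ) (z : ℝ) {l : ℤ}
    (hl : l < 0) {e : ℕ} (he : Even ((e : ℤ) - (u + l + 1))) :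
    rightRow r s β u z l = ((-1 : ℝ) ^ e * Phi (-u - l - 1) (β - z) : ℝ) := by
  have h := lineMom_sub_lineMom_neg hr hs one_pos (2 * (z - β)) (u + l)
  have he' := neg_one_zpow_eq_pow he
  rw [zpow_add_one₀ (by norm_num)] at he'
  rw [rightRow, if_pos hl]
  rw [show -(2 * (z - β)) = 2 * (β - z) by ring, lineMom_one hs (β - z),
    show -(u + l) - 1 = -u - l - 1 by ring] at h
  push_cast at h ⊢
  rw [← he']
  linear_combination -h

lemma prod_neg_one_pow_add (N c : ℕ) :
    ∏ i ∈ Finset.range N, (-1 : ℝ) ^ (c + i) = (-1) ^ (N * c + N * (N - 1) / 2) := by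
  rw [Finset.prod_pow_eq_pow_sum, Finset.sum_add_distrib, Finset.sum_range_id]
  simp

lemma prod_Ico_one_eq (δ : ℕ) : ∏ l ∈ Finset.Ico 1 δ, (2 : ℝ) ^ l / (l.factorial : ℝ)
    = ∏ l ∈ Finset.range δ, (2 : ℝ) ^ l / (l.factorial : ℝ) := by
  rcases Nat.eq_zero_or_pos δ with rfl | h
  · simp
  · rw [Finset.range_eq_Ico, Finset.prod_eq_prod_Ico_succ_bot h]
    simp

lemma det_leftRow_of_le {r s : ℝ} (hr : 0 < r) (hs : 0 < s) (β : ℝ) {ρ P d : ℕ} {u : ℤ}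
    (hd : (d : ℤ) = ρ - u) (hP : (P : ℤ) = max (-u) 0) (z : Fin (0 + ρ + P) → ℝ) :
    (Matrix.of fun i j : Fin (0 + ρ + P) =>
        leftRow r s β ρ u (z j) ((i : ℕ) - (0 + ρ : ℕ))).det
      = ((∏ i ∈ Finset.range (0 + ρ + P), (-1 : ℝ) ^ (d + 1 + i)) * (1 / 2) ^ d
        * secondDet β ρ u z : ℝ) := by
  have h := det_Phi_rows (N := 0 + ρ + P) (d := d) (by omega) 1 β z
  -- The sign of the reversal cancels the signs of the leading coefficients, leaving `1/2` per
  -- Gaussian row.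
  have h1 : (-1 : ℝ) ^ (d * (d - 1) / 2) * ∏ k ∈ Finset.range d, ((-1 : ℝ) ^ k / 2) = (1 / 2) ^ d := by
    rw [Finset.prod_div_distrib, Finset.prod_pow_eq_pow_sum, Finset.sum_range_id, ← mul_div_assoc,
      ← pow_add, Even.neg_one_pow ⟨_, rfl⟩]
    simp
  rw [h1] at h
  have h2 : secondDet β ρ u z = (Matrix.of fun k j : Fin (0 + ρ + P) =>
      if (k : ℕ) < d then z j ^ (k : ℕ) * gauss (1 * z j + β)
      else Phi (((k : ℕ) : ℤ) - d) (1 * z j + β)).det := by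
    unfold secondDet
    congr 1
    ext k j
    simp only [Matrix.of_apply, one_mul]
    by_cases hk : (k : ℕ) < d
    · rw [if_pos hk, if_pos (by omega)]
    · rw [if_neg hk, if_neg (by omega), hd, add_comm β]
  rw [← h2] at h
  rw [mul_assoc, ← h, Finset.prod_range, ← Matrix.det_mul_column, ← det_ofReal]
  congr 1
  ext i j
  simp only [Matrix.of_apply]
  rw [leftRow_of_ge hr hs β u (z j) (by push_cast; omega) (e := d + 1 + i)
    ⟨d, by push_cast; omega⟩, one_mul]
  congr 3
  push_cast
  omega

lemma det_rightRow_of_le {r s : ℝ} (hr : 0 < r) (hs : 0 < s) (β : ℝ) {ρ P v N : ℕ} {u : ℤ} (hN : N = 0 + ρ + P)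
    (hv : (v : ℤ) = max u 0) (hP : (P : ℤ) = max (-u) 0) (z : Fin N → ℝ) :
    (Matrix.of fun i j : Fin N =>
        rightRow r s β u (z j) ((i : ℕ) - (0 + ρ : ℕ))).det
      = ((-1 : ℝ) ^ (N * (N - 1) / 2)
        * (∏ k ∈ Finset.range N, if k < P then 2 ^ k / (k.factorial : ℝ) else (-1) ^ (k + v))
        * firstDet β u z : ℝ) := by
  choose f hf hfe using exists_isPolyLead_circMom hr 1 2 (-2 * β)
  have h := det_poly_rows (N := N) P (fun k => if k < P then 2 ^ k / (k.factorial : ℝ)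
      else (-1) ^ (k + v)) (f := f) (fun k hk => by rw [if_pos hk]; exact hf k) (fun _ => 1) z
    (fun k j => Phi ((k : ℤ) - max u 0) (β - z j))
  have h2 : firstDet β u z = (Matrix.of fun k j : Fin N =>
      if (k : ℕ) < P then z j ^ (k : ℕ) * 1 else Phi (((k : ℕ) : ℤ) - max u 0) (β - z j)).det := by
    unfold firstDet
    congr 1
    ext k j
    simp only [Matrix.of_apply, mul_one]
    exact if_congr (by omega) rfl rfl
  -- Row `i` carries the polynomial or `Phi` row of index `N - 1 - i`, so the whole matrix has to be
  -- reversed.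
  have h3 := det_reverse_first (R := ℝ) (N := N) le_rfl (fun k j =>
    if k < P then f k (z j) * 1 else (if k < P then 2 ^ k / (k.factorial : ℝ) else (-1) ^ (k + v))
      * Phi ((k : ℤ) - max u 0) (β - z j)) (fun _ _ => 0)
  simp only [Fin.is_lt, if_true] at h3
  rw [h2, mul_assoc, ← h, ← h3, ← det_ofReal]
  congr 1
  ext i j
  have hi := i.2
  simp only [Matrix.of_apply]
  have hk : ((N - 1 - (i : ℕ) : ℕ) : ℤ) = N - 1 - i := by omega
  split_ifs with hlt
  · have h4 := hfe (N - 1 - i) (z j)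
    rw [rightRow, if_neg (by omega), mul_one, ← h4, sub_zero, hk]
    push_cast
    congr 1
    · ring
    · omega
  · rw [rightRow_of_neg hr hs β u (z j) (by omega) (e := N - 1 - i + v)
      ⟨N - 1 - i, by push_cast [hk]; omega⟩]
    congr 3
    omega

lemma tacnodeDet_eq_levelProduct {r s : ℝ} (hr : 0 < r) (hrs : r < s) (β : ℝ) {ρ N : ℕ} {u : ℤ}
    (hu : u ≤ ρ) (hN : (N : ℤ) = max (ρ - u) ρ) (z : Fin N → ℝ) :
    tacnodeDet r s β ρ u z = (levelProduct r s β ρ u z : ℂ) := by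
  obtain ⟨D, hD, hDe⟩ := exists_fredholmDet_eq hr hrs β ρ
  have hs := hr.trans hrs
  set P := (-u).toNat with hPdef
  have hP : (P : ℤ) = max (-u) 0 := by omega
  set v := u.toNat with hvdef
  have hv : (v : ℤ) = max u 0 := by omega
  obtain ⟨d, hd⟩ := Int.eq_ofNat_of_zero_le (sub_nonneg.2 hu)
  obtain rfl : N = 0 + ρ + P := by omega
  rw [tacnodeDet_eq_mul_det hr hrs β (a := 0) (by rw [hDe]; exact_mod_cast hD.ne')
    (by push_cast; omega) hP, det_leftRow_of_le hr hs β hd.symm hP, det_rightRow_of_le hr hs β rfl hv hP,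
    hDe, levelProduct, constC, hDe, Complex.ofReal_re, prod_Ico_one_eq, ← hPdef, ← hvdef]
  have h1 : ∏ k ∈ Finset.range (0 + ρ + P), (if k < P then 2 ^ k / (k.factorial : ℝ)
      else (-1) ^ (k + v)) = (∏ k ∈ Finset.range P, 2 ^ k / (k.factorial : ℝ))
        * (-1) ^ (ρ * (P + v) + ρ * (ρ - 1) / 2) := by
    rw [zero_add, add_comm ρ, Finset.prod_range_add, ← prod_neg_one_pow_add]
    congr 1
    · exact Finset.prod_congr rfl fun k hk => if_pos (Finset.mem_range.1 hk)
    · refine Finset.prod_congr rfl fun k _ => ?_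
      rw [if_neg (by omega)]
      congr 1
      ring
  have h2 : (2 : ℝ) ^ (0 + ρ + P) * (1 / 2) ^ d = 2 ^ v := by
    rw [show 0 + ρ + P = v + d by omega, pow_add, mul_assoc, ← mul_pow]
    norm_num
  have h3 : (-1 : ℝ) ^ ((0 + ρ + P) * (d + 1) + (0 + ρ + P) * (0 + ρ + P - 1) / 2)
      * (-1) ^ ((0 + ρ + P) * (0 + ρ + P - 1) / 2) * (-1) ^ (ρ * (P + v) + ρ * (ρ - 1) / 2)
      = (-1) ^ (ρ * (ρ - 1) / 2 + ρ * P) := by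
    rw [← pow_add, ← pow_add]
    apply neg_one_pow_congr
    -- The only part of the exponent that does not occur twice; for either sign of `u` it is a
    -- product of consecutive integers.
    have h4 : Even ((0 + ρ + P) * (d + 1) + ρ * v) := by
      rcases le_total u 0 with h | h
      · have e1 : v = 0 := by omega
        have e2 : d = 0 + ρ + P := by omega
        rw [e1, e2, mul_zero, add_zero]
        exact Nat.even_mul_succ_self _
      · have e1 : P = 0 := by omega
        have e2 : ρ = d + v := by omega
        rw [e1, e2, show (0 + (d + v) + 0) * (d + 1) + (d + v) * v = (d + v) * (d + v + 1) by ring]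
        exact Nat.even_mul_succ_self _
    rw [show (0 + ρ + P) * (d + 1) + (0 + ρ + P) * (0 + ρ + P - 1) / 2
      + (0 + ρ + P) * (0 + ρ + P - 1) / 2 + (ρ * (P + v) + ρ * (ρ - 1) / 2)
      + (ρ * (ρ - 1) / 2 + ρ * P) = ((0 + ρ + P) * (d + 1) + ρ * v)
      + ((0 + ρ + P) * (0 + ρ + P - 1) / 2 + ρ * (ρ - 1) / 2 + ρ * P)
      + ((0 + ρ + P) * (0 + ρ + P - 1) / 2 + ρ * (ρ - 1) / 2 + ρ * P) by ring, add_assoc]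
    exact h4.add ⟨_, rfl⟩
  rw [h1, prod_neg_one_pow_add, ← h2, ← h3]
  push_cast
  ring

/-! ### Levels above the overlap -/

/-- Here `u` is the number of rows. The `a` lowest left rows contain no line moment and are
polynomials, while every right row is a `Phi` of negative index, hence a polynomial times a
Gaussian. -/
lemma tacnodeDet_eq_densityX {r s : ℝ} (hr : 0 < r) (hrs : r < s) (β : ℝ) {ρ n : ℕ}
    (hn : ρ ≤ n) (x : Fin n → ℝ) :
    tacnodeDet r s β ρ n x = (densityX r s β ρ x : ℂ) := by
  obtain ⟨D, hD, hDe⟩ := exists_fredholmDet_eq hr hrs β ρ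
  have hs := hr.trans hrs
  obtain ⟨a, rfl⟩ : ∃ a, n = a + ρ + 0 := ⟨n - ρ, by omega⟩
  have hleft : (Matrix.of fun i j : Fin (a + ρ + 0) =>
        leftRow r s β ρ (a + ρ + 0 : ℕ) (x j) ((i : ℕ) - (a + ρ : ℕ))).det
      = ((∏ k ∈ Finset.range (a + ρ + 0),
          if k < a then -((-2) ^ k / (k.factorial : ℝ)) else (-1) ^ (k + 1))
        * vanderExt β 1 ρ x : ℝ) := by
    choose f hf hfe using exists_isPolyLead_circMom hr 1 (-2) (-2 * β)
    have h := det_poly_rows (N := a + ρ + 0) a (fun k =>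
        if k < a then -((-2) ^ k / (k.factorial : ℝ)) else (-1) ^ (k + 1))
      (f := fun k z => -1 * f k z) (fun k hk => by
        rw [if_pos hk, neg_eq_neg_one_mul]; exact (hf k).const_mul (-1)) (fun _ => 1) x
      (fun k j => Phi k (β + 1 * x j))
    have h2 : vanderExt β 1 ρ x = (Matrix.of fun k j : Fin (a + ρ + 0) =>
        if (k : ℕ) < a then x j ^ (k : ℕ) * 1 else Phi ((k : ℕ) : ℤ) (β + 1 * x j)).det := by
      unfold vanderExt
      congr 1
      ext k j
      simp only [Matrix.of_apply, mul_one]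
      exact if_congr (by omega) rfl rfl
    rw [h2, ← h, ← det_ofReal]
    congr 1
    ext i j
    simp only [Matrix.of_apply]
    split_ifs with hi
    · have h4 := hfe i (x j)
      rw [leftRow, if_neg (by push_cast; omega), mul_one, Complex.ofReal_mul, ← h4, zero_sub, cMom]
      push_cast
      rw [neg_one_mul]
      congr 2
      · ring
      · ring
    · rw [leftRow_of_ge hr hs β _ (x j) (by push_cast; omega) (e := i + 1)
        ⟨0, by push_cast; ring⟩]
      congr 3
      · push_cast; ring
      · ring
  have hright : (Matrix.of fun i j : Fin (a + ρ + 0) =>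
        rightRow r s β (a + ρ + 0 : ℕ) (x j) ((i : ℕ) - (a + ρ : ℕ))).det
      = ((∏ k ∈ Finset.range (a + ρ + 0), (-1 : ℝ) ^ (k + 1) * (1 / 2))
        * (vander x * ∏ i, gauss (x i - β)) : ℝ) := by
    choose f hf hfe using exists_isPolyLead_Phi_negSucc (-1) β
    have h := det_poly_rows (N := a + ρ + 0) (a + ρ + 0) (fun k => (-1 : ℝ) ^ (k + 1) * (1 / 2))
      (f := fun k z => (-1) ^ (k + 1) * f k z) (fun k _ => by
        have := (hf k).const_mul ((-1) ^ (k + 1))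
        rwa [neg_neg, one_pow] at this) (fun z => gauss (z - β)) x (fun k j => 0)
    simp only [Fin.is_lt, if_true] at h
    have h2 : (Matrix.of fun k j : Fin (a + ρ + 0) => x j ^ (k : ℕ) * gauss (x j - β)).det
        = vander x * ∏ i, gauss (x i - β) := by
      rw [vander, mul_comm, ← Matrix.det_mul_row]
      congr 1
      ext i j
      simp [mul_comm]
    rw [← h2, ← h, ← det_ofReal]
    congr 1
    ext i j
    simp only [Matrix.of_apply]
    have hi := i.2
    rw [rightRow_of_neg hr hs β _ (x j) (by push_cast; omega) (e := i + 1)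
      ⟨0, by push_cast; ring⟩]
    have h4 := hfe i (x j)
    rw [show (-1 * x j + β) = -(x j - β) by ring, gauss_neg] at h4
    rw [mul_assoc, ← h4]
    congr 3
    · push_cast; ring
    · ring
  rw [tacnodeDet_eq_mul_det hr hrs β (by rw [hDe]; exact_mod_cast hD.ne') (by push_cast; omega)
    (by push_cast; omega), hleft, hright, hDe, densityX, constC, hDe, Complex.ofReal_re,
    prod_Ico_one_eq, show a + ρ + 0 - ρ = a by omega]
  -- Row by row the factor `2` meets `1/2` and the two signs cancel; only the polynomial rows leave
  -- `2^k / k!`.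
  have h1 : (2 : ℝ) ^ (a + ρ + 0) * ((∏ k ∈ Finset.range (a + ρ + 0),
      if k < a then -((-2) ^ k / (k.factorial : ℝ)) else (-1) ^ (k + 1))
      * ∏ k ∈ Finset.range (a + ρ + 0), (-1 : ℝ) ^ (k + 1) * (1 / 2))
      = ∏ k ∈ Finset.range a, 2 ^ k / (k.factorial : ℝ) := by
    have h2 : (2 : ℝ) ^ (a + ρ + 0) = ∏ _k ∈ Finset.range (a + ρ + 0), 2 := by simp
    rw [h2, ← Finset.prod_mul_distrib, ← Finset.prod_mul_distrib, add_zero, Finset.prod_range_add,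
      Finset.prod_eq_one (s := Finset.range ρ), mul_one]
    · refine Finset.prod_congr rfl fun k hk => ?_
      rw [if_pos (Finset.mem_range.1 hk), show (-2 : ℝ) ^ k = (-1) ^ k * 2 ^ k by
        rw [← mul_pow]; norm_num, pow_succ]
      have : ((-1 : ℝ) ^ k) ^ 2 = 1 := by rw [← pow_mul, mul_comm, pow_mul]; norm_num
      linear_combination 2 ^ k / (k.factorial : ℝ) * this
    · intro k _
      rw [if_neg (by omega)]
      have : ((-1 : ℝ) ^ (a + k + 1)) ^ 2 = 1 := by rw [← pow_mul, mul_comm, pow_mul]; norm_num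
      linear_combination this
  rw [← h1]
  push_cast
  ring

/-! ### The product formula in its special forms -/

lemma levelProduct_eq_densityY (r s β : ℝ) {ρ n : ℕ} (hn : ρ ≤ n) (y : Fin n → ℝ) :
    levelProduct r s β ρ (ρ - n) y = densityY r s β ρ y := by
  have h1 : firstDet β (ρ - n) y = vanderExt β (-1) ρ y := by
    unfold firstDet vanderExt
    congr 1
    ext k j
    simp only [Matrix.of_apply]
    refine if_congr (by omega) rfl ?_
    rw [neg_one_mul, ← sub_eq_add_neg]
    congr 1
    omega
  have h2 : secondDet β ρ (ρ - n) y = vander y * ∏ i, gauss (y i + β) := by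
    rw [vander, mul_comm, ← Matrix.det_mul_row, secondDet]
    congr 1
    ext k j
    simp only [Matrix.of_apply]
    rw [if_pos (by omega), mul_comm]
  have e1 : (-((ρ : ℤ) - n)).toNat = n - ρ := by omega
  have e2 : ((ρ : ℤ) - n).toNat = 0 := by omega
  rw [levelProduct, densityY, h1, h2, e1, e2]
  ring

lemma overlapDet_eq (b σ : ℝ) {d ρ : ℕ} (hd : d ≤ ρ) (z : Fin ρ → ℝ) :
    overlapDet b σ d z = (-1) ^ (d * (d - 1) / 2) * (Matrix.of fun k j : Fin ρ =>
      if (k : ℕ) < d then z j ^ (k : ℕ) * gauss (z j + b)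
      else Phi (((k : ℕ) : ℤ) - d) (σ * (z j + b))).det := by
  rw [← det_reverse_first hd (fun k j => z j ^ k * gauss (z j + b))
    (fun k j => Phi ((k : ℤ) - d) (σ * (z j + b)))]
  rfl

lemma triangle_add (d e : ℕ) :
    (d + e) * (d + e - 1) / 2 = d * (d - 1) / 2 + e * (e - 1) / 2 + d * e := by
  rw [← Finset.sum_range_id, ← Finset.sum_range_id, ← Finset.sum_range_id, Finset.sum_range_add,
    Finset.sum_add_distrib]
  simp
  ring

/-- Reducing `Phi_{-d}, …, Phi_{-1}` to Gaussian monomials produces `2^{-d}`, which cancels `2^u`.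
With `ρ = d + e`, the part `e(e-1)/2` of the sign exponent is absorbed by reversing the monomials of
the second determinant. -/
lemma levelProduct_eq_densityOverlap (r s β : ℝ) {ρ d : ℕ} (hd : d ≤ ρ) (z : Fin ρ → ℝ) :
    levelProduct r s β ρ d z = densityOverlap r s β d z := by
  obtain ⟨e, rfl⟩ := Nat.exists_eq_add_of_le hd
  have hsq : ∀ m : ℕ, (-1 : ℝ) ^ m * (-1) ^ m = 1 := fun m => by rw [← mul_pow]; norm_num
  have h1 : firstDet β d z = (1 / 2) ^ d * overlapDet (-β) (-1) d z := by
    have h := det_Phi_rows hd (-1) β z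
    rw [overlapDet_eq _ _ hd]
    have h2 : firstDet β d z
        = (Matrix.of fun k j : Fin (d + e) => Phi (((k : ℕ) : ℤ) - d) (-1 * z j + β)).det := by
      unfold firstDet
      congr 1
      ext k j
      simp only [Matrix.of_apply]
      rw [if_neg (by omega), show -1 * z j + β = β - z j by ring]
      congr 1
      omega
    have h3 : ∏ k ∈ Finset.range d, ((- -1 : ℝ) ^ k / 2) = (1 / 2) ^ d := by simp
    have h4 : ∀ j, gauss (-1 * z j + β) = gauss (z j + -β) := fun j => by
      rw [← gauss_neg]; congr 1; ring
    have h5 : ∀ j, -1 * z j + β = -1 * (z j + -β) := fun j => by ring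
    rw [h2, h, h3]
    simp only [h4]
    simp only [h5]
    ring
  have h2 : secondDet β (d + e) d z = (-1) ^ (e * (e - 1) / 2) * overlapDet β 1 e z := by
    rw [overlapDet_eq _ _ (by omega), ← mul_assoc, hsq, one_mul]
    unfold secondDet
    congr 1
    ext k j
    simp only [Matrix.of_apply]
    refine if_congr (by omega) rfl ?_
    rw [one_mul, add_comm β]
    congr 1
    omega
  rw [levelProduct, densityOverlap, h1, h2, show d + e - d = e by omega,
    show (-(d : ℤ)).toNat = 0 by omega, Int.toNat_natCast, triangle_add, mul_zero, add_zero,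
    show d * (d - 1) / 2 + e * (e - 1) / 2 + d * e
      = d * (d - 1) / 2 + d * e + e * (e - 1) / 2 by ring, pow_add _ _ (e * (e - 1) / 2)]
  have h3 : (2 : ℝ) ^ d * (1 / 2) ^ d = 1 := by rw [← mul_pow]; norm_num
  linear_combination (-1 : ℝ) ^ (d * (d - 1) / 2 + d * e) * constC r s β (d + e) 0
    * overlapDet (-β) (-1) d z * overlapDet β 1 e z
    * ((2 : ℝ) ^ d * (1 / 2) ^ d * hsq (e * (e - 1) / 2) + h3)

/-! ### From the top correlation function to the density -/

lemma volume_not_injective (N : ℕ) :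
    (volume : Measure (Fin N → ℝ)) {z | ¬ Function.Injective z} = 0 := by
  have h : {z : Fin N → ℝ | ¬ Function.Injective z}
      ⊆ ⋃ i : Fin N, ⋃ j : Fin N, ⋃ _ : i ≠ j, {z | z i = z j} := by
    intro z hz
    simp only [Function.Injective, Set.mem_ofPred_eq, not_forall] at hz
    obtain ⟨i, j, h1, h2⟩ := hz
    simp only [Set.mem_iUnion]
    exact ⟨i, j, h2, h1⟩
  refine measure_mono_null h ?_
  simp only [measure_iUnion_null_iff]
  intro i j hij
  set L : (Fin N → ℝ) →ₗ[ℝ] ℝ :=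
    (LinearMap.proj i : (Fin N → ℝ) →ₗ[ℝ] ℝ) - LinearMap.proj j with hL
  have hset : {z : Fin N → ℝ | z i = z j} = (LinearMap.ker L : Set (Fin N → ℝ)) := by
    ext z
    simp [hL, sub_eq_zero]
  rw [hset]
  refine Measure.addHaar_submodule _ _ fun htop => ?_
  have : Pi.single i (1 : ℝ) ∈ LinearMap.ker L := by rw [htop]; trivial
  simp [hL, hij.symm] at this

lemma measurableSet_injective (N : ℕ) : MeasurableSet {z : Fin N → ℝ | Function.Injective z} := by
  have h : {z : Fin N → ℝ | Function.Injective z}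
      = ⋂ i : Fin N, ⋂ j : Fin N, ⋂ _ : i ≠ j, {z | z i ≠ z j} := by
    ext z
    simp only [Function.Injective, Set.mem_ofPred_eq, Set.mem_iInter]
    exact forall₂_congr fun i j => not_imp_not.symm
  rw [h]
  exact MeasurableSet.iInter fun i => MeasurableSet.iInter fun j => MeasurableSet.iInter fun _ =>
    (measurableSet_eq_fun (measurable_pi_apply i) (measurable_pi_apply j)).compl

lemma measurableSet_monotone (N : ℕ) : MeasurableSet {z : Fin N → ℝ | Monotone z} := by
  have h : {z : Fin N → ℝ | Monotone z}
      = ⋂ i : Fin N, ⋂ j : Fin N, ⋂ _ : i ≤ j, {z | z i ≤ z j} := by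
    ext z
    simp [Monotone]
  rw [h]
  exact MeasurableSet.iInter fun i => MeasurableSet.iInter fun j => MeasurableSet.iInter fun _ =>
    measurableSet_le (measurable_pi_apply i) (measurable_pi_apply j)

/-- An ordered tuple composed with a permutation is ordered only if the permutation is trivial. -/
lemma embedding_eq_refl {N : ℕ} {z : Fin N → ℝ} (hz : Monotone z) (hi : Function.Injective z)
    {e : Fin N ↪ Fin N} (he : Monotone (z ∘ e)) : e = Function.Embedding.refl _ := by
  have hs := hz.strictMono_of_injective hi
  have hes : StrictMono e := fun i j hij => by
    have := he.strictMono_of_injective (hi.comp e.injective) hij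
    exact hs.lt_iff_lt.1 this
  ext i
  simp [Fin.ext_iff.1 (congrFun (hes.range_inj strictMono_id |>.1 (by
    rw [(Finite.injective_iff_surjective.1 e.injective).range_eq, Set.range_id])) i)]

/-- Self-embeddings of `Fin N` are permutations, so the `N`-point correlation is the law summed over
relabellings; testing on ordered tuples isolates one of them. -/
lemma hasLevelDensity_of_tacnodeDet_eq {r s β : ℝ} {ρ : ℕ} {u : ℤ} {N : ℕ}
    {p : (Fin N → ℝ) → ℝ} (h : ∀ z : Fin N → ℝ, tacnodeDet r s β ρ u z = (p z : ℂ)) :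
    HasLevelDensity r s β ρ u N p := by
  intro P hP
  have hcorr := hP.correlation N
  simp only [h, Complex.ofReal_re] at hcorr
  have hnm : MeasurableSet {z : Fin N → ℝ | ¬ Function.Injective z} :=
    (measurableSet_injective N).compl
  -- Ties must be excluded, since several relabellings of a tuple with ties are ordered. The
  -- correlation measure has a density, so it does not charge the diagonals.
  have hinj : ∀ᵐ z ∂P, Function.Injective z := by
    have h1 := hcorr ({z : Fin N → ℝ | ¬ Function.Injective z}.indicator 1)
      (measurable_one.indicator hnm)
    have h2 : ∫⁻ x : Fin N → ℝ, {z : Fin N → ℝ | ¬ Function.Injective z}.indicator 1 x * ENNReal.ofReal (p x)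
        = 0 := by
      rw [lintegral_congr_ae (g := fun _ => 0), lintegral_zero]
      filter_upwards [measure_eq_zero_iff_ae_notMem.1 (volume_not_injective N)] with z hz
      rw [Set.indicator_of_notMem hz, zero_mul]
    rw [h2] at h1
    have h3 : P {z : Fin N → ℝ | ¬ Function.Injective z} ≤ 0 := by
      rw [← h1, ← lintegral_indicator_one hnm]
      refine lintegral_mono fun z => ?_
      exact Finset.single_le_sum
        (f := fun e : Fin N ↪ Fin N => {z : Fin N → ℝ | ¬ Function.Injective z}.indicator (1 : (Fin N → ℝ) → ℝ≥0∞) (z ∘ e))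
        (fun _ _ => zero_le) (Finset.mem_univ (Function.Embedding.refl _))
    exact le_antisymm h3 zero_le
  ext S hS
  have hSm : MeasurableSet (S ∩ {z : Fin N → ℝ | Monotone z}) := hS.inter (measurableSet_monotone N)
  rw [withDensity_apply _ hS, Measure.restrict_restrict hS, ← lintegral_indicator hSm]
  have h1 := hcorr ((S ∩ {z : Fin N → ℝ | Monotone z}).indicator 1) (measurable_one.indicator hSm)
  have h2 : ∫⁻ x : Fin N → ℝ, (S ∩ {z : Fin N → ℝ | Monotone z}).indicator 1 x * ENNReal.ofReal (p x)
      = ∫⁻ x, (S ∩ {z : Fin N → ℝ | Monotone z}).indicator (fun z => ENNReal.ofReal (p z)) x := by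
    refine lintegral_congr fun x => ?_
    by_cases hx : x ∈ S ∩ {z : Fin N → ℝ | Monotone z}
    · rw [Set.indicator_of_mem hx, Set.indicator_of_mem hx, Pi.one_apply, one_mul]
    · rw [Set.indicator_of_notMem hx, Set.indicator_of_notMem hx, zero_mul]
  rw [← h2, ← h1, ← lintegral_indicator_one hS]
  refine lintegral_congr_ae ?_
  filter_upwards [hinj, hP.ordered] with z hz hm
  rw [Finset.sum_eq_single (Function.Embedding.refl _)]
  · rw [show z ∘ (Function.Embedding.refl (Fin N)) = z from rfl]
    by_cases hzS : z ∈ S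
    · rw [Set.indicator_of_mem hzS, Set.indicator_of_mem (Set.mem_inter hzS hm)]
    · rw [Set.indicator_of_notMem hzS, Set.indicator_of_notMem fun h' => hzS h'.1]
  · intro e _ he
    exact Set.indicator_of_notMem (fun h' => he (embedding_eq_refl hm hz h'.2)) _
  · intro h'; exact absurd (Finset.mem_univ _) h'

end Tacnode

end

theorem theorem5p1 (β : ℝ) (hβ : 0 ≤ β) (ρ : ℕ) (hρ : 1 ≤ ρ)
    (r s : ℝ) (hr : 0 < r) (hrs : r < s) :
    -- the objects entering the kernel and the constants are well defined
    ((Tacnode.fredholmDet r s β ρ).im = 0 ∧ 0 < (Tacnode.fredholmDet r s β ρ).re ∧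
      (∀ a : ℕ → ℂ, (Summable fun i => ‖a i‖ ^ 2) →
        ∃! g : ℕ → ℂ, Tacnode.IsResolventSolution r s β ρ a g) ∧
      (∀ (u : ℤ) (y : ℝ),
        Summable fun j : ℕ => ‖Tacnode.funA r s β u (y - β) ((j : ℤ) - ρ)‖ ^ 2)) ∧
    -- every level `u ≤ ρ`
    (∀ (u : ℤ) (N : ℕ), u ≤ ρ → (N : ℤ) = max (ρ - u) ρ →
      (∀ z : Fin N → ℝ,
        Tacnode.tacnodeDet r s β ρ u z = (Tacnode.levelProduct r s β ρ u z : ℂ)) ∧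
      Tacnode.HasLevelDensity r s β ρ u N (Tacnode.levelProduct r s β ρ u)) ∧
    -- outside the overlap
    (∀ n : ℕ, ρ ≤ n →
      (∀ x : Fin n → ℝ,
        Tacnode.tacnodeDet r s β ρ n x = (Tacnode.densityX r s β ρ x : ℂ)) ∧
      Tacnode.HasLevelDensity r s β ρ n n (Tacnode.densityX r s β ρ) ∧
      (∀ y : Fin n → ℝ,
        Tacnode.tacnodeDet r s β ρ (ρ - n) y = (Tacnode.densityY r s β ρ y : ℂ)) ∧
      Tacnode.HasLevelDensity r s β ρ (ρ - n) n (Tacnode.densityY r s β ρ)) ∧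
    -- inside the overlap
    (∀ d : ℕ, 1 ≤ d → d ≤ ρ - 1 →
      (∀ z : Fin ρ → ℝ,
        Tacnode.tacnodeDet r s β ρ d z = (Tacnode.densityOverlap r s β d z : ℂ)) ∧
      Tacnode.HasLevelDensity r s β ρ d ρ (Tacnode.densityOverlap r s β d)) := by
  obtain ⟨D, hD, hDe⟩ := Tacnode.exists_fredholmDet_eq hr hrs β ρ
  have hD0 : Tacnode.fredholmDet r s β ρ ≠ 0 := by rw [hDe]; exact_mod_cast hD.ne'
  refine ⟨⟨by rw [hDe, Complex.ofReal_im], by rwa [hDe, Complex.ofReal_re],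
    fun a ha => Tacnode.existsUnique_isResolventSolution hr hrs β hD0 ha,
    fun u y => (Tacnode.geomDecay_funA hr hrs β ρ u (y - β)).summable_sq⟩,
    fun u N hu hN => ?_, fun n hn => ?_, fun d hd hd' => ?_⟩
  · have h := Tacnode.tacnodeDet_eq_levelProduct hr hrs β hu hN
    exact ⟨h, Tacnode.hasLevelDensity_of_tacnodeDet_eq h⟩
  · have hx := Tacnode.tacnodeDet_eq_densityX hr hrs β hn
    have hy : ∀ y : Fin n → ℝ,
        Tacnode.tacnodeDet r s β ρ (ρ - n) y = (Tacnode.densityY r s β ρ y : ℂ) := fun y => by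
      rw [Tacnode.tacnodeDet_eq_levelProduct hr hrs β (by omega) (by omega),
        Tacnode.levelProduct_eq_densityY r s β hn]
    exact ⟨hx, Tacnode.hasLevelDensity_of_tacnodeDet_eq hx, hy,
      Tacnode.hasLevelDensity_of_tacnodeDet_eq hy⟩
  · have h : ∀ z : Fin ρ → ℝ,
        Tacnode.tacnodeDet r s β ρ d z = (Tacnode.densityOverlap r s β d z : ℂ) := fun z => by
      rw [Tacnode.tacnodeDet_eq_levelProduct hr hrs β (by omega) (by omega),
        Tacnode.levelProduct_eq_densityOverlap r s β (by omega)]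
    exact ⟨h, Tacnode.hasLevelDensity_of_tacnodeDet_eq h⟩
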